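/- Let $n\ge 0$ and let $(M,g)$ be a smooth Riemannian manifold of dimension $2n+1$ with Levi-Civita connection $\nabla$. Write $\chi(M)$ for the smooth vector fields on $M$, and put $R(X,Y)Z=\nabla_X\nabla_YZ-\nabla_Y\nabla_XZ-\nabla_{[X,Y]}Z$ and $S(Y,Z)=\operatorname{trace}\{X\mapsto R(X,Y)Z\}$ (the Ricci tensor). Let $\phi$ be a smooth $(1,1)$-tensor field, $\xi$ a smooth vector field and $\eta$ a smooth $1$-form such that $(\phi,\xi,\eta,g)$ is a Sasakian structure, i.e. for all $X,Y\in\chi(M)$: * (almost contact metric) $\phi^2X=-X+\eta(X)\xi$, $\eta(\xi)=1$, $\eta\circ\phi=0$, $\phi\xi=0$, $g(\phi X,\phi Y)=g(X,Y)-\eta(X)\eta(Y)$, $g(X,\phi Y)=-g(\phi X,Y)$, $g(X,\xi)=\eta(X)$; * (contact metric) $d\eta(X,Y)=g(X,\phi Y)$, where $d\eta(X,Y)=\tfrac12\big(X\eta(Y)-Y\eta(X)-\eta([X,Y])\big)$; * (normal) $2\,d\eta(X,Y)\,\xi+[\phi,\phi](X,Y)=0$, where $[\phi,\phi](X,Y)=\phi^2[X,Y]+[\phi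 X,\phi Y]-\phi[\phi X,Y]-\phi[X,\phi Y]$. Let $S^*(X,Y)=\tfrac12\operatorname{trace}\{\phi\circ R(X,\phi Y)\}$ be the $*$-Ricci tensor. Suppose that $M$ admits a $*$-conformal $\eta$-Ricci soliton: there are real constants $\lambda,\mu$ and a function $p:M\to\mathbb R$ with $$\pounds_\xi g+2S^*+\Big[2\lambda-\Big(p+\frac{2}{2n+1}\Big)\Big]g+2\mu\,\eta\otimes\eta=0,$$ where $\pounds_\xi g$ is the Lie derivative of $g$ along $\xi$. Then the Ricci tensor of $M$ is cyclic parallel: for all $X,Y,Z\in\chi(M)$, $$(\nabla_XS)(Y,Z)+(\nabla_YS)(Z,X)+(\nabla_ZS)(X,Y)=0 ,$$ where $(\nabla_XS)(Y,Z)=X\,S(Y,Z)-S(\nabla_XY,Z)-S(Y,\nabla_XZ)$. -/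

import Mathlib

open Bundle FiberBundle VectorField
open scoped Manifold ContDiff Topology

noncomputable section

namespace SasakianSoliton

variable {E : Type*} [NormedAddCommGroup E] [NormedSpace ℝ E]
  {H : Type*} [TopologicalSpace H] {I : ModelWithCorners ℝ E H}
  {M : Type*} [TopologicalSpace M] [ChartedSpace H M]

section Basics

/-- A smooth vector field on `M`, i.e. an element of `χ(M)`. -/
def IsSmoothField [IsManifold I ∞ M] (X : Π x : M, TangentSpace I x) : Prop :=
  ContMDiff I I.tangent ∞ (fun x ↦ (⟨x, X x⟩ : TangentBundle I M))

/-- `X f`, the derivative of the function `f` along the vector field `X`. -/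
def dirDeriv (X : Π x : M, TangentSpace I x) (f : M → ℝ) (x : M) : ℝ :=
  mvfderiv I f x (X x)

/-- The Nijenhuis tensor
`[φ,φ](X,Y) = φ²[X,Y] + [φX,φY] - φ[φX,Y] - φ[X,φY]` of a (1,1)-tensor field `φ`. -/
def nijenhuis (φ : Π x : M, TangentSpace I x →L[ℝ] TangentSpace I x)
    (X Y : Π x : M, TangentSpace I x) (x : M) : TangentSpace I x :=
  φ x (φ x (mlieBracket I X Y x))
    + mlieBracket I (fun y ↦ φ y (X y)) (fun y ↦ φ y (Y y)) x
    - φ x (mlieBracket I (fun y ↦ φ y (X y)) Y x)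
    - φ x (mlieBracket I X (fun y ↦ φ y (Y y)) x)

/-- The exterior derivative of a 1-form, with the normalization usual in contact geometry:
`dη(X,Y) = (1/2) (X η(Y) - Y η(X) - η([X,Y]))`. -/
def extDerivOneForm (η : Π x : M, TangentSpace I x →L[ℝ] ℝ)
    (X Y : Π x : M, TangentSpace I x) (x : M) : ℝ :=
  (1 / 2) * (dirDeriv X (fun y ↦ η y (Y y)) x - dirDeriv Y (fun y ↦ η y (X y)) x
    - η x (mlieBracket I X Y x))

end Basics

section Metric

variable [RiemannianBundle (fun x : M ↦ TangentSpace I x)]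

/-- The function `g(X,Y)` for vector fields `X` and `Y`. -/
def metric (X Y : Π x : M, TangentSpace I x) (x : M) : ℝ := inner ℝ (X x) (Y x)

/-- The Lie derivative of the metric:
`(£_V g)(X,Y) = V g(X,Y) - g([V,X],Y) - g(X,[V,Y])`. -/
def lieDerivMetric (V X Y : Π x : M, TangentSpace I x) (x : M) : ℝ :=
  dirDeriv V (metric X Y) x - inner ℝ (mlieBracket I V X x) (Y x)
    - inner ℝ (X x) (mlieBracket I V Y x)

/-- Half of the right-hand side of the Koszul formula for `2 g(∇_X Y, Z)`. -/
def koszul (X Y Z : Π x : M, TangentSpace I x) (x : M) : ℝ :=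
  (1 / 2) * (dirDeriv X (metric Y Z) x + dirDeriv Y (metric Z X) x - dirDeriv Z (metric X Y) x
    - inner ℝ (X x) (mlieBracket I Y Z x) - inner ℝ (Y x) (mlieBracket I X Z x)
    + inner ℝ (Z x) (mlieBracket I X Y x))

end Metric

section LeviCivita

variable [IsManifold I ∞ M]
  [RiemannianBundle (fun x : M ↦ TangentSpace I x)]
  [IsContMDiffRiemannianBundle I ∞ E (fun x : M ↦ TangentSpace I x)]

theorem metric_mdiff {X Y : Π x : M, TangentSpace I x} {x : M}
    (hX : MDiffAt (T% X) x) (hY : MDiffAt (T% Y) x) : MDiffAt (metric X Y) x :=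
  MDifferentiableAt.inner_bundle hX hY

variable [FiniteDimensional ℝ E]

theorem koszul_tensorial_left {Y Z : Π x : M, TangentSpace I x} {x : M}
    (hY : MDiffAt (T% Y) x) (hZ : MDiffAt (T% Z) x) :
    TensorialAt I E (fun X ↦ koszul X Y Z x) x where
  smul {f X} hf hX := by
    have h1 : metric Z (f • X) = fun y ↦ f y * metric Z X y := by
      ext y; simp [metric, inner_smul_right]
    have h2 : metric (f • X) Y = fun y ↦ f y * metric X Y y := by
      ext y; simp [metric, inner_smul_left]
    simp only [koszul, dirDeriv, h1, h2]
    rw [mvfderiv_fun_mul hf (metric_mdiff hZ hX), mvfderiv_fun_mul hf (metric_mdiff hX hY),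
      mlieBracket_smul_left hf hX, mlieBracket_smul_left hf hX]
    simp [inner_add_right, inner_smul_right, inner_smul_left, metric]
    simp only [real_inner_comm]
    ring
  add {X X'} hX hX' := by
    have h1 : metric Z (X + X') = fun y ↦ metric Z X y + metric Z X' y := by
      ext y; simp [metric, inner_add_right]
    have h2 : metric (X + X') Y = fun y ↦ metric X Y y + metric X' Y y := by
      ext y; simp [metric, inner_add_left]
    simp only [koszul, dirDeriv, h1, h2]
    rw [mvfderiv_fun_add (metric_mdiff hZ hX) (metric_mdiff hZ hX'),
      mvfderiv_fun_add (metric_mdiff hX hY) (metric_mdiff hX' hY),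
      mlieBracket_add_left hX hX', mlieBracket_add_left hX hX']
    simp [inner_add_right, inner_add_left]
    ring

theorem koszul_tensorial_right {X Y : Π x : M, TangentSpace I x} {x : M}
    (hX : MDiffAt (T% X) x) (hY : MDiffAt (T% Y) x) :
    TensorialAt I E (fun Z ↦ koszul X Y Z x) x where
  smul {f Z} hf hZ := by
    have h1 : metric Y (f • Z) = fun y ↦ f y * metric Y Z y := by
      ext y; simp [metric, inner_smul_right]
    have h2 : metric (f • Z) X = fun y ↦ f y * metric Z X y := by
      ext y; simp [metric, inner_smul_left]
    simp only [koszul, dirDeriv, h1, h2]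
    rw [mvfderiv_fun_mul hf (metric_mdiff hY hZ), mvfderiv_fun_mul hf (metric_mdiff hZ hX),
      mlieBracket_smul_right hf hZ, mlieBracket_smul_right hf hZ]
    simp [inner_add_right, inner_smul_right, inner_smul_left, metric]
    rw [real_inner_comm (X x) (Z x)]
    ring
  add {Z Z'} hZ hZ' := by
    have h1 : metric Y (Z + Z') = fun y ↦ metric Y Z y + metric Y Z' y := by
      ext y; simp [metric, inner_add_right]
    have h2 : metric (Z + Z') X = fun y ↦ metric Z X y + metric Z' X y := by
      ext y; simp [metric, inner_add_left]
    simp only [koszul, dirDeriv, h1, h2]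
    rw [mvfderiv_fun_add (metric_mdiff hY hZ) (metric_mdiff hY hZ'),
      mvfderiv_fun_add (metric_mdiff hZ hX) (metric_mdiff hZ' hX),
      mlieBracket_add_right hZ hZ', mlieBracket_add_right hZ hZ']
    simp [inner_add_right, inner_add_left]
    ring

open Classical in
/-- The bilinear form `(u, w) ↦ g(∇_u Y, w)` on `T_x M`, read off from the Koszul formula. -/
def koszulForm (Y : Π x : M, TangentSpace I x) (x : M) :
    TangentSpace I x →L[ℝ] TangentSpace I x →L[ℝ] ℝ :=
  if hY : MDiffAt (T% Y) x then
    TensorialAt.mkHom₂ (fun X Z ↦ koszul X Y Z x) x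
      (fun _ hZ ↦ koszul_tensorial_left hY hZ) (fun _ hX ↦ koszul_tensorial_right hX hY)
  else 0

theorem koszulForm_apply {X Y Z : Π x : M, TangentSpace I x} {x : M}
    (hX : MDiffAt (T% X) x) (hY : MDiffAt (T% Y) x) (hZ : MDiffAt (T% Z) x) :
    koszulForm Y x (X x) (Z x) = koszul X Y Z x := by
  rw [koszulForm, dif_pos hY]
  exact TensorialAt.mkHom₂_apply _ _ hX hZ

instance instFiniteDimensionalTangentSpace (x : M) : FiniteDimensional ℝ (TangentSpace I x) :=
  inferInstanceAs (FiniteDimensional ℝ E)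

/-- `∇Y` at `x`, as an endomorphism of the tangent space: `∇_u Y` is the vector such that
`g(∇_u Y, w)` is given by the Koszul formula, for all `w`. -/
def leviCivitaFun (Y : Π x : M, TangentSpace I x) (x : M) :
    TangentSpace I x →L[ℝ] TangentSpace I x :=
  LinearMap.toContinuousLinearMap
    { toFun := fun u ↦ (InnerProductSpace.toDual ℝ (TangentSpace I x)).symm (koszulForm Y x u)
      map_add' := by intro u v; simp
      map_smul' := by intro c u; simp }

theorem inner_leviCivitaFun (Y : Π x : M, TangentSpace I x) (x : M) (u w : TangentSpace I x) :
    inner ℝ (leviCivitaFun Y x u) w = koszulForm Y x u w := by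
  simp [leviCivitaFun]

theorem leviCivitaFun_eq_iff {Y : Π x : M, TangentSpace I x} {x : M}
    (hY : MDiffAt (T% Y) x) {A : TangentSpace I x →L[ℝ] TangentSpace I x}
    (h : ∀ X Z : Π x : M, TangentSpace I x, MDiffAt (T% X) x → MDiffAt (T% Z) x →
      koszul X Y Z x = inner ℝ (A (X x)) (Z x)) : leviCivitaFun Y x = A := by
  ext u
  refine ext_inner_right ℝ fun w ↦ ?_
  have hu : MDiffAt (T% (extend E u : Π x : M, TangentSpace I x)) x := mdifferentiableAt_extend ..
  have hw : MDiffAt (T% (extend E w : Π x : M, TangentSpace I x)) x := mdifferentiableAt_extend ..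
  have := h _ _ hu hw
  rw [← koszulForm_apply hu hY hw] at this
  simpa [inner_leviCivitaFun] using this

theorem inner_leviCivitaFun_field {X Y Z : Π x : M, TangentSpace I x} {x : M}
    (hX : MDiffAt (T% X) x) (hY : MDiffAt (T% Y) x) (hZ : MDiffAt (T% Z) x) :
    inner ℝ (leviCivitaFun Y x (X x)) (Z x) = koszul X Y Z x := by
  rw [inner_leviCivitaFun, koszulForm_apply hX hY hZ]

variable (I M) in
/-- The Levi-Civita connection of the Riemannian metric. -/
def leviCivita : CovariantDerivative I E (TangentSpace I : M → Type _) where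
  toFun := leviCivitaFun
  isCovariantDerivativeOnUniv :=
    { add := by
        intro Y Y' x hY hY' _
        refine leviCivitaFun_eq_iff (mdifferentiableAt_add_section hY hY') fun X Z hX hZ ↦ ?_
        have h1 : metric (Y + Y') Z = fun y ↦ metric Y Z y + metric Y' Z y := by
          ext y; simp [metric, inner_add_left]
        have h2 : metric X (Y + Y') = fun y ↦ metric X Y y + metric X Y' y := by
          ext y; simp [metric, inner_add_right]
        rw [add_apply, inner_add_left, inner_leviCivitaFun_field hX hY hZ,
          inner_leviCivitaFun_field hX hY' hZ]
        simp only [koszul, dirDeriv, h1, h2]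
        rw [mvfderiv_fun_add (metric_mdiff hY hZ) (metric_mdiff hY' hZ),
          mvfderiv_fun_add (metric_mdiff hX hY) (metric_mdiff hX hY'),
          mlieBracket_add_right hY hY', mlieBracket_add_left hY hY']
        simp [inner_add_right, inner_add_left]
        ring
      leibniz := by
        intro Y f x hY hf _
        refine leviCivitaFun_eq_iff (hf.smul_section hY) fun X Z hX hZ ↦ ?_
        have h1 : metric (f • Y) Z = fun y ↦ f y * metric Y Z y := by
          ext y; simp [metric, inner_smul_left]
        have h2 : metric X (f • Y) = fun y ↦ f y * metric X Y y := by
          ext y; simp [metric, inner_smul_right]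
        rw [add_apply, inner_add_left, smul_apply,
          real_inner_smul_left, inner_leviCivitaFun_field hX hY hZ]
        simp only [koszul, dirDeriv, h1, h2]
        rw [mvfderiv_fun_mul hf (metric_mdiff hY hZ), mvfderiv_fun_mul hf (metric_mdiff hX hY),
          mlieBracket_smul_right hf hY, mlieBracket_smul_left hf hY]
        simp [inner_add_right, inner_smul_right, inner_smul_left, metric]
        rw [real_inner_comm (Y x) (Z x)]
        ring }

/-- The Levi-Civita connection is torsion-free: `∇_X Y - ∇_Y X = [X,Y]`. -/
theorem leviCivita_torsion {X Y : Π x : M, TangentSpace I x} {x : M}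
    (hX : MDiffAt (T% X) x) (hY : MDiffAt (T% Y) x) :
    leviCivita I M Y x (X x) - leviCivita I M X x (Y x) = mlieBracket I X Y x := by
  refine ext_inner_right ℝ fun w ↦ ?_
  have hw : MDiffAt (T% (extend E w : Π x : M, TangentSpace I x)) x := mdifferentiableAt_extend ..
  have h1 := inner_leviCivitaFun_field hX hY hw
  have h2 := inner_leviCivitaFun_field hY hX hw
  have h3 : metric Y X = metric X Y := by ext y; exact real_inner_comm _ _
  have h4 : metric X (extend E w) = metric (extend E w) X := by ext y; exact real_inner_comm _ _
  have h5 : metric Y (extend E w) = metric (extend E w) Y := by ext y; exact real_inner_comm _ _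
  rw [extend_apply_self] at h1 h2
  change inner ℝ (leviCivitaFun Y x (X x) - leviCivitaFun X x (Y x)) w = _
  rw [inner_sub_left, h1, h2]
  simp only [koszul, h3, h4, h5, extend_apply_self]
  rw [mlieBracket_swap_apply (V := Y) (W := X), inner_neg_right, real_inner_comm w]
  ring

/-- The Levi-Civita connection is compatible with the metric:
`X g(Y,Z) = g(∇_X Y, Z) + g(Y, ∇_X Z)`. -/
theorem leviCivita_metric {X Y Z : Π x : M, TangentSpace I x} {x : M}
    (hX : MDiffAt (T% X) x) (hY : MDiffAt (T% Y) x) (hZ : MDiffAt (T% Z) x) :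
    dirDeriv X (metric Y Z) x =
      inner ℝ (leviCivita I M Y x (X x)) (Z x) + inner ℝ (Y x) (leviCivita I M Z x (X x)) := by
  have h1 := inner_leviCivitaFun_field hX hY hZ
  have h2 := inner_leviCivitaFun_field hX hZ hY
  have h3 : metric Z Y = metric Y Z := by ext y; exact real_inner_comm _ _
  have h4 : metric X Z = metric Z X := by ext y; exact real_inner_comm _ _
  have h5 : metric X Y = metric Y X := by ext y; exact real_inner_comm _ _
  rw [real_inner_comm _ (Y x)]
  change _ = inner ℝ (leviCivitaFun Y x (X x)) (Z x) + inner ℝ (leviCivitaFun Z x (X x)) (Y x)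
  rw [h1, h2]
  simp only [koszul, h3, h4, h5]
  rw [mlieBracket_swap_apply (V := Z) (W := Y), inner_neg_right]
  ring

/-- The curvature on vector fields:
`R(X,Y)Z = ∇_X ∇_Y Z - ∇_Y ∇_X Z - ∇_{[X,Y]} Z`. -/
def curvatureField (X Y Z : Π x : M, TangentSpace I x) (x : M) : TangentSpace I x :=
  leviCivita I M (fun y ↦ leviCivita I M Z y (Y y)) x (X x)
    - leviCivita I M (fun y ↦ leviCivita I M Z y (X y)) x (Y x)
    - leviCivita I M Z x (mlieBracket I X Y x)

/-- The curvature tensor `R(u,v)w` on tangent vectors at `x`, computed on vector fields that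
are smooth near `x` and take the values `u`, `v`, `w` at `x`. (The curvature is tensorial, so the
choice of these fields does not matter; `FiberBundle.extend` is constant in a trivialization.) -/
def curvature (x : M) (u v w : TangentSpace I x) : TangentSpace I x :=
  curvatureField (extend E u) (extend E v) (extend E w) x

/-- The trace of an endomorphism of a tangent space, computed in an orthonormal basis. -/
def traceTangent (x : M) (A : TangentSpace I x → TangentSpace I x) : ℝ :=
  ∑ i, inner ℝ (A (stdOrthonormalBasis ℝ (TangentSpace I x) i))
    (stdOrthonormalBasis ℝ (TangentSpace I x) i)

/-- The Ricci tensor `S(v,w) = trace (u ↦ R(u,v)w)`. -/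
def ricci (x : M) (v w : TangentSpace I x) : ℝ :=
  traceTangent x fun u ↦ curvature x u v w

/-- The `*`-Ricci tensor `S*(u,v) = (1/2) trace (φ ∘ R(u, φ v))`. -/
def starRicci (φ : Π x : M, TangentSpace I x →L[ℝ] TangentSpace I x)
    (x : M) (u v : TangentSpace I x) : ℝ :=
  (1 / 2) * traceTangent x fun w ↦ φ x (curvature x u (φ x v) w)

/-- The covariant derivative of a (0,2)-tensor field:
`(∇_X T)(Y,Z) = X T(Y,Z) - T(∇_X Y,Z) - T(Y,∇_X Z)`. -/
def covDerivTensor (T : Π x : M, TangentSpace I x → TangentSpace I x → ℝ)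
    (X Y Z : Π x : M, TangentSpace I x) (x : M) : ℝ :=
  dirDeriv X (fun y ↦ T y (Y y) (Z y)) x
    - T x (leviCivita I M Y x (X x)) (Z x) - T x (Y x) (leviCivita I M Z x (X x))

end LeviCivita

section Sasakian

variable [IsManifold I ∞ M] [RiemannianBundle (fun x : M ↦ TangentSpace I x)]

/-- `(φ, ξ, η)` together with the Riemannian metric is an almost contact metric structure. -/
structure IsAlmostContactMetric (φ : Π x : M, TangentSpace I x →L[ℝ] TangentSpace I x)
    (ξ : Π x : M, TangentSpace I x) (η : Π x : M, TangentSpace I x →L[ℝ] ℝ) : Prop where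
  smooth_phi : ContMDiff I (I.prod 𝓘(ℝ, E →L[ℝ] E)) ∞
    (fun x ↦ (⟨x, φ x⟩ :
      TotalSpace (E →L[ℝ] E) (fun x : M ↦ TangentSpace I x →L[ℝ] TangentSpace I x)))
  smooth_xi : IsSmoothField ξ
  smooth_eta : ContMDiff I (I.prod 𝓘(ℝ, E →L[ℝ] ℝ)) ∞
    (fun x ↦ (⟨x, η x⟩ :
      TotalSpace (E →L[ℝ] ℝ) (fun x : M ↦ TangentSpace I x →L[ℝ] Bundle.Trivial M ℝ x)))
  phi_phi : ∀ x v, φ x (φ x v) = -v + η x v • ξ x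
  eta_xi : ∀ x, η x (ξ x) = 1
  eta_phi : ∀ x v, η x (φ x v) = 0
  phi_xi : ∀ x, φ x (ξ x) = 0
  inner_phi_phi : ∀ x v w, inner ℝ (φ x v) (φ x w) = inner ℝ v w - η x v * η x w
  inner_phi_right : ∀ x v w, inner ℝ v (φ x w) = -inner ℝ (φ x v) w
  inner_xi : ∀ x v, inner ℝ v (ξ x) = η x v

/-- `(φ, ξ, η)` together with the Riemannian metric is a Sasakian structure: a contact metric
structure, `dη(X,Y) = g(X, φY)`, that is normal, `2 dη(X,Y) ξ + [φ,φ](X,Y) = 0`. -/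
structure IsSasakian (φ : Π x : M, TangentSpace I x →L[ℝ] TangentSpace I x)
    (ξ : Π x : M, TangentSpace I x) (η : Π x : M, TangentSpace I x →L[ℝ] ℝ) : Prop extends
    IsAlmostContactMetric φ ξ η where
  contact : ∀ X Y : Π x : M, TangentSpace I x, IsSmoothField X → IsSmoothField Y →
    ∀ x, extDerivOneForm η X Y x = inner ℝ (X x) (φ x (Y x))
  normal : ∀ X Y : Π x : M, TangentSpace I x, IsSmoothField X → IsSmoothField Y →
    ∀ x, (2 * extDerivOneForm η X Y x) • ξ x + nijenhuis φ X Y x = 0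

variable [IsContMDiffRiemannianBundle I ∞ E (fun x : M ↦ TangentSpace I x)]
  [FiniteDimensional ℝ E]

/-- The `*`-conformal `η`-Ricci soliton equation on a manifold of dimension `m`:
`£_ξ g + 2 S* + [2λ - (p + 2/m)] g + 2μ η ⊗ η = 0`,
where `λ`, `μ` are constants and `p` is a scalar field. -/
def IsStarConformalEtaRicciSoliton (φ : Π x : M, TangentSpace I x →L[ℝ] TangentSpace I x)
    (ξ : Π x : M, TangentSpace I x) (η : Π x : M, TangentSpace I x →L[ℝ] ℝ)
    (lam mu : ℝ) (p : M → ℝ) : Prop :=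
  ∀ X Y : Π x : M, TangentSpace I x, IsSmoothField X → IsSmoothField Y → ∀ x,
    lieDerivMetric ξ X Y x + 2 * starRicci φ x (X x) (Y x)
      + (2 * lam - (p x + 2 / (Module.finrank ℝ E : ℝ))) * inner ℝ (X x) (Y x)
      + 2 * mu * (η x (X x) * η x (Y x)) = 0

end Sasakian

end SasakianSoliton

end

/-!
The soliton equation forces the metric to be `η`-Einstein with constant coefficients,
`S = a g + b η ⊗ η`. Then `∇S` only involves `(∇_X η)(Y) = -g(Y, φX)`, which is skew in `X` and `Y`,
so its cyclic sum vanishes.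

The `η`-Einstein condition comes from three facts about a Sasakian manifold of dimension `m`.

* `ξ` is a Killing field (`dirDeriv_xi_metric`), so `£_ξ g` drops out of the soliton equation. This
  holds because normality and the contact condition make `φ`, `η` and `dη` invariant under `ξ`.
* `S*(·, ξ) = 0` (`starRicci_xi`), since `φξ = 0`. Evaluating the soliton equation at `(ξ, ξ)` then
  shows that the coefficient `2λ - (p + 2/m)` is the constant `-2μ`, whatever the function `p` was.
* `S* = S - (m - 2) g - η ⊗ η` (`starRicci_eq`). This trace identity rests on the symmetries of the
  curvature and on the commutator of `R(X,Y)` with `φ` (`curvature_phi`), which is computed from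
  `∇_X ξ = -φX` (`nabla_xi`) and `(∇_X φ)Y = g(X,Y)ξ - η(Y)X` (`nablaPhi_eq`).

The general Riemannian facts needed for this are developed for globally smooth vector fields:
`∇_X Y` is smooth (`IsSmoothField.nabla`), the curvature has its usual symmetries, and it is
tensorial (`curvature_apply`). The last point links the pointwise definition of `curvature`, through local
extensions of tangent vectors, to covariant derivatives of arbitrary smooth fields.
-/

noncomputable section

namespace SasakianSoliton

variable {E : Type*} [NormedAddCommGroup E] [NormedSpace ℝ E]
  {H : Type*} [TopologicalSpace H] {I : ModelWithCorners ℝ E H}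
  {M : Type*} [TopologicalSpace M] [ChartedSpace H M]

/-! ### Calculus of smooth vector fields -/

section Calculus

theorem dirDeriv_const (X : Π x : M, TangentSpace I x) (c : ℝ) (x : M) :
    dirDeriv X (fun _ ↦ c) x = 0 := by
  have h0 : mvfderiv I (fun _ : M ↦ c) x = 0 := mvfderiv_const _
  simp [dirDeriv, h0]

theorem dirDeriv_mul {f g : M → ℝ} (X : Π x : M, TangentSpace I x) (x : M)
    (hf : MDiffAt f x) (hg : MDiffAt g x) :
    dirDeriv X (fun y ↦ f y * g y) x = f x * dirDeriv X g x + dirDeriv X f x * g x := by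
  simp only [dirDeriv]
  rw [mvfderiv_fun_mul hf hg]
  simp
  ring

theorem dirDeriv_add {f g : M → ℝ} (X : Π x : M, TangentSpace I x) (x : M)
    (hf : MDiffAt f x) (hg : MDiffAt g x) :
    dirDeriv X (fun y ↦ f y + g y) x = dirDeriv X f x + dirDeriv X g x := by
  simp only [dirDeriv]
  rw [mvfderiv_fun_add hf hg]
  simp

variable [IsManifold I ∞ M]

theorem IsSmoothField.mdiffAt {X : Π x : M, TangentSpace I x} (hX : IsSmoothField X) (x : M) :
    MDiffAt (T% X) x :=
  (hX x).mdifferentiableAt (by simp)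

theorem IsSmoothField.smul {f : M → ℝ} {X : Π x : M, TangentSpace I x}
    (hf : ContMDiff I 𝓘(ℝ) ∞ f) (hX : IsSmoothField X) : IsSmoothField (fun y ↦ f y • X y) :=
  ContMDiff.smul_section hf hX

theorem IsSmoothField.add {X Y : Π x : M, TangentSpace I x}
    (hX : IsSmoothField X) (hY : IsSmoothField Y) : IsSmoothField (fun y ↦ X y + Y y) :=
  ContMDiff.add_section hX hY

theorem IsSmoothField.neg {X : Π x : M, TangentSpace I x}
    (hX : IsSmoothField X) : IsSmoothField (fun y ↦ -X y) :=
  ContMDiff.neg_section hX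

theorem contMDiff_dirDeriv {f : M → ℝ} {X : Π x : M, TangentSpace I x}
    (hf : ContMDiff I 𝓘(ℝ) ∞ f) (hX : IsSmoothField X) :
    ContMDiff I 𝓘(ℝ) ∞ (dirDeriv X f) := by
  intro x
  have h1 := (hf x).mfderiv_const (m := ∞) (by simp)
  have h2 : ContMDiffAt I (𝓘(ℝ).prod 𝓘(ℝ)) ∞
      (fun y ↦ (⟨f y, mfderiv I 𝓘(ℝ) f y (X y)⟩ : TangentBundle 𝓘(ℝ) ℝ)) x :=
    ContMDiffAt.clm_apply_of_inCoordinates h1 (hX x) (hf x)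
  rw [contMDiffAt_totalSpace] at h2
  have h3 := h2.2
  simp only [trivializationAt_model_space_apply] at h3
  exact h3

theorem IsSmoothField.mlieBracket {X Y : Π x : M, TangentSpace I x} [CompleteSpace E]
    (hX : IsSmoothField X) (hY : IsSmoothField Y) : IsSmoothField (mlieBracket I X Y) := fun x ↦
  haveI : IsManifold I (((⊤ : ℕ∞) : ℕ∞ω) + 1) M := ‹IsManifold I ∞ M›
  haveI : IsManifold I (minSmoothness ℝ 2) M :=
    IsManifold.of_le (n := ∞) (by simpa using ENat.LEInfty.out)
  haveI : IsManifold I (minSmoothness ℝ 3) M :=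
    IsManifold.of_le (n := ∞) (by simpa using ENat.LEInfty.out)
  ContMDiffAt.mlieBracket_vectorField (m := ⊤) (n := ⊤) (hX x) (hY x) (by simp)

/-- The Jacobi identity. -/
theorem jacobi {X Y Z : Π x : M, TangentSpace I x} [CompleteSpace E]
    (hX : IsSmoothField X) (hY : IsSmoothField Y) (hZ : IsSmoothField Z) (x : M) :
    mlieBracket I X (mlieBracket I Y Z) x =
      mlieBracket I (mlieBracket I X Y) Z x + mlieBracket I Y (mlieBracket I X Z) x :=
  haveI : IsManifold I (minSmoothness ℝ 3) M :=
    IsManifold.of_le (n := ∞) (by simpa using ENat.LEInfty.out)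
  have h2 : minSmoothness ℝ 2 ≤ ∞ := by simpa using ENat.LEInfty.out
  leibniz_identity_mlieBracket_apply ((hX x).of_le h2) ((hY x).of_le h2) ((hZ x).of_le h2)

theorem mlieBracket_fun_smul_right {f : M → ℝ} {X Y : Π x : M, TangentSpace I x} (x : M)
    [CompleteSpace E] (hf : MDiffAt f x) (hY : MDiffAt (T% Y) x) :
    mlieBracket I X (fun y ↦ f y • Y y) x = dirDeriv X f x • Y x + f x • mlieBracket I X Y x :=
  mlieBracket_smul_right hf hY

/-- A vector field that is smooth near `x` agrees near `x` with a globally smooth one: multiply it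
by a bump function. This uses that `M` is Hausdorff. -/
theorem exists_smooth_extension [FiniteDimensional ℝ E] [T2Space M] (X : Π x : M, TangentSpace I x)
    {x : M} {u : Set M} (hu : u ∈ 𝓝 x) (hX : CMDiff[u] ∞ (T% X)) :
    ∃ V : Π x : M, TangentSpace I x, IsSmoothField V ∧ V =ᶠ[𝓝 x] X := by
  obtain ⟨v, hvu, hv, hxv⟩ := mem_nhds_iff.1 hu
  obtain ⟨f, hf, -⟩ := (SmoothBumpFunction.nhds_basis_support (I := I) (hv.mem_nhds hxv)).mem_iff.1
    (hv.mem_nhds hxv)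
  refine ⟨(f : M → ℝ) • X, ContMDiffOn.smul_section_of_tsupport f.contMDiff.contMDiffOn hv hf
    (hX.mono hvu), ?_⟩
  filter_upwards [f.eventuallyEq_one] with y hy
  simp [Pi.smul_apply', hy]
  rfl

theorem exists_smooth_eventuallyEq_extend [FiniteDimensional ℝ E] [T2Space M] {x : M}
    (v : TangentSpace I x) :
    ∃ V : Π x : M, TangentSpace I x, IsSmoothField V ∧
      V =ᶠ[𝓝 x] (extend E v : Π x : M, TangentSpace I x) := by
  obtain ⟨s, hs, h⟩ := exists_contMDiffOn_extend (k := ∞) I E v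
  exact exists_smooth_extension _ hs h

theorem exists_smooth_field [FiniteDimensional ℝ E] [T2Space M] {x : M} (v : TangentSpace I x) :
    ∃ V : Π x : M, TangentSpace I x, IsSmoothField V ∧ V x = v := by
  obtain ⟨V, hV, h⟩ := exists_smooth_eventuallyEq_extend v
  exact ⟨V, hV, h.self_of_nhds.trans (extend_apply_self ..)⟩

/-- `[X,Y]` acts on functions as the commutator of `X` and `Y`: apply the Jacobi identity to
`X`, `Y` and `f Z`, where `Z` does not vanish at the given point. -/
theorem dirDeriv_mlieBracket [FiniteDimensional ℝ E] [T2Space M] {f : M → ℝ}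
    {X Y : Π x : M, TangentSpace I x} (hf : ContMDiff I 𝓘(ℝ) ∞ f) (hX : IsSmoothField X)
    (hY : IsSmoothField Y) (x : M) :
    dirDeriv (mlieBracket I X Y) f x =
      dirDeriv X (dirDeriv Y f) x - dirDeriv Y (dirDeriv X f) x := by
  have : CompleteSpace E := FiniteDimensional.complete ℝ E
  -- if `T_x M = 0`, both sides vanish
  by_cases hE : ∃ v : TangentSpace I x, v ≠ 0
  · obtain ⟨v, hv⟩ := hE
    obtain ⟨Z, hZ, rfl⟩ := exists_smooth_field v
    have md {g : M → ℝ} (hg : ContMDiff I 𝓘(ℝ) ∞ g) (x : M) : MDiffAt g x :=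
      (hg x).mdifferentiableAt (by simp)
    have key {V W : Π x : M, TangentSpace I x} (hV : IsSmoothField V) (hW : IsSmoothField W) :
        mlieBracket I V (mlieBracket I W fun y ↦ f y • Z y) x =
          dirDeriv V (dirDeriv W f) x • Z x + dirDeriv W f x • mlieBracket I V Z x
          + (dirDeriv V f x • mlieBracket I W Z x
            + f x • mlieBracket I V (mlieBracket I W Z) x) := by
      have h1 : mlieBracket I W (fun y ↦ f y • Z y) =
          (fun y ↦ dirDeriv W f y • Z y) + fun y ↦ f y • mlieBracket I W Z y := by
        ext y
        exact mlieBracket_fun_smul_right y (md hf y) (hZ.mdiffAt y)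
      have h2 := contMDiff_dirDeriv hf hW
      rw [h1, mlieBracket_add_right ((hZ.smul h2).mdiffAt x)
          (((hW.mlieBracket hZ).smul hf).mdiffAt x),
        mlieBracket_fun_smul_right x (md h2 x) (hZ.mdiffAt x),
        mlieBracket_fun_smul_right x (md hf x) ((hW.mlieBracket hZ).mdiffAt x)]
    have h := jacobi hX hY (hZ.smul hf) x
    rw [key hX hY, key hY hX, mlieBracket_fun_smul_right x (md hf x) (hZ.mdiffAt x),
      jacobi hX hY hZ x] at h
    have h3 : (dirDeriv (mlieBracket I X Y) f x -
        (dirDeriv X (dirDeriv Y f) x - dirDeriv Y (dirDeriv X f) x)) • Z x = 0 := by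
      linear_combination (norm := module) (-1 : ℝ) • h
    exact sub_eq_zero.1 ((smul_eq_zero.1 h3).resolve_right hv)
  · push Not at hE
    simp [dirDeriv, hE (mlieBracket I X Y x), hE (X x), hE (Y x)]

end Calculus

section Smoothness

variable [IsManifold I ∞ M] [RiemannianBundle (fun x : M ↦ TangentSpace I x)]
  [IsContMDiffRiemannianBundle I ∞ E (fun x : M ↦ TangentSpace I x)]

theorem IsSmoothField.metric {X Y : Π x : M, TangentSpace I x}
    (hX : IsSmoothField X) (hY : IsSmoothField Y) : ContMDiff I 𝓘(ℝ) ∞ (metric X Y) :=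
  ContMDiff.inner_bundle hX hY

theorem mdiffAt_metric {X Y : Π x : M, TangentSpace I x} (hX : IsSmoothField X)
    (hY : IsSmoothField Y) (x : M) : MDiffAt (metric X Y) x :=
  metric_mdiff (hX.mdiffAt x) (hY.mdiffAt x)

/-- A vector field is smooth as soon as its inner products with all smooth fields are:
its coefficients in a local frame solve a linear system whose matrix, the Gram matrix of the frame,
is smooth and invertible. -/
theorem isSmoothField_of_metric [FiniteDimensional ℝ E] [T2Space M] {V : Π x : M, TangentSpace I x}
    (h : ∀ W : Π x : M, TangentSpace I x, IsSmoothField W →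
      ContMDiff I 𝓘(ℝ) ∞ (SasakianSoliton.metric V W)) :
    IsSmoothField V := by
  intro x
  set e := trivializationAt E (TangentSpace I : M → Type _) x with he
  have hx : x ∈ e.baseSet := FiberBundle.mem_baseSet_trivializationAt' x
  set b := Module.finBasis ℝ E
  have hW (i) := exists_smooth_extension (e.localFrame b i) (e.open_baseSet.mem_nhds hx)
    (e.contMDiffOn_localFrame_baseSet (I := I) ∞ b i)
  choose W hW hWe using hW
  have hWe' : ∀ᶠ y in 𝓝 x, ∀ i, W i y = e.localFrame b i y := Filter.eventually_all.2 hWe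
  let c (i) : M → ℝ := fun y ↦ e.localFrameCoeff I b i y (V y)
  -- `A y` is the Gram matrix of the fields `W i` at `y`, as a linear map
  let B (i j : Fin (Module.finrank ℝ E)) :
      (Fin (Module.finrank ℝ E) → ℝ) →L[ℝ] (Fin (Module.finrank ℝ E) → ℝ) :=
    (ContinuousLinearMap.proj j).smulRight (Pi.single i 1)
  let A (y : M) := ∑ i, ∑ j, SasakianSoliton.metric (W i) (W j) y • B i j
  have hA (y : M) (a : Fin (Module.finrank ℝ E) → ℝ) (i) :
      A y a i = inner ℝ (W i y) (∑ j, a j • W j y) := by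
    simp [A, B, SasakianSoliton.metric, inner_sum, inner_smul_right, Finset.sum_apply,
      Pi.single_apply, mul_comm]
  have hAs : ContMDiffAt I
      𝓘(ℝ, (Fin (Module.finrank ℝ E) → ℝ) →L[ℝ] (Fin (Module.finrank ℝ E) → ℝ)) ∞ A x :=
    contMDiffAt_finsetSum fun i _ ↦ contMDiffAt_finsetSum fun j _ ↦
      ((hW i).metric (hW j) x).smul contMDiffAt_const
  have hinv : ∀ᶠ y in 𝓝 x, (A y).IsInvertible ∧ A y (fun i ↦ c i y) =
      fun i ↦ SasakianSoliton.metric V (W i) y := by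
    filter_upwards [hWe', e.open_baseSet.mem_nhds hx] with y hy hye
    have hbas (i) : W i y = e.basisAt b hye i := by
      rw [hy, e.localFrame_apply_of_mem_baseSet b hye]
    constructor
    · have hinj : Function.Injective (A y) := by
        rw [injective_iff_map_eq_zero]
        intro a ha
        have h0 : ∑ j, a j • W j y = 0 := by
          rw [← inner_self_eq_zero (𝕜 := ℝ), sum_inner]
          refine Finset.sum_eq_zero fun i _ ↦ ?_
          rw [inner_smul_left, ← hA, ha]
          simp
        simp only [hbas] at h0
        exact funext
          (Fintype.linearIndependent_iff.1 (e.basisAt b hye).linearIndependent a h0)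
      exact ⟨(LinearEquiv.ofInjectiveEndo (A y).toLinearMap hinj).toContinuousLinearEquiv, rfl⟩
    · ext i
      rw [hA, SasakianSoliton.metric, real_inner_comm,
        e.eq_sum_localFrameCoeff_smul (I := I) (b := b) (s := V) hye]
      simp [c, hy]
  have hc : ContMDiffAt I 𝓘(ℝ, Fin (Module.finrank ℝ E) → ℝ) ∞ (fun y i ↦ c i y) x := by
    have h1 : ContMDiffAt I 𝓘(ℝ, Fin (Module.finrank ℝ E) → ℝ) ∞
        (fun y ↦ (A y).inverse (fun i ↦ SasakianSoliton.metric V (W i) y)) x := by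
      refine ContMDiffAt.clm_apply ?_ ?_
      · exact (hinv.self_of_nhds.1.contDiffAt_map_inverse (n := ∞)).contMDiffAt.comp x hAs
      · exact contMDiffAt_pi_space.2 fun i ↦ h (W i) (hW i) x
    refine h1.congr_of_eventuallyEq ?_
    filter_upwards [hinv] with y hy
    obtain ⟨⟨L, hL⟩, hy2⟩ := hy
    rw [← hy2, ← hL]
    simp
  exact (contMDiffAt_iff_localFrameCoeff b hx).2 fun i ↦ contMDiffAt_pi_space.1 hc i

end Smoothness

/-! ### The Levi-Civita connection on smooth vector fields -/

section Connection

variable [IsManifold I ∞ M] [RiemannianBundle (fun x : M ↦ TangentSpace I x)]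
  [IsContMDiffRiemannianBundle I ∞ E (fun x : M ↦ TangentSpace I x)]
  [FiniteDimensional ℝ E]

/-- The vector field `∇_X Y`. -/
def nabla (X Y : Π x : M, TangentSpace I x) (x : M) : TangentSpace I x :=
  leviCivita I M Y x (X x)

/-- `R(X,Y)Z = ∇_X ∇_Y Z - ∇_Y ∇_X Z - ∇_{[X,Y]} Z`, in terms of `nabla`. -/
theorem curvatureField_eq (X Y Z : Π x : M, TangentSpace I x) (x : M) :
    curvatureField X Y Z x =
      nabla X (nabla Y Z) x - nabla Y (nabla X Z) x - nabla (mlieBracket I X Y) Z x :=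
  rfl

theorem nabla_add_right (X : Π x : M, TangentSpace I x) {Y Z : Π x : M, TangentSpace I x} {x : M}
    (hY : MDiffAt (T% Y) x) (hZ : MDiffAt (T% Z) x) :
    nabla X (fun y ↦ Y y + Z y) x = nabla X Y x + nabla X Z x :=
  congr($((leviCivita I M).isCovariantDerivativeOnUniv.add hY hZ) (X x))

theorem nabla_smul_right (X : Π x : M, TangentSpace I x) {f : M → ℝ}
    {Y : Π x : M, TangentSpace I x} {x : M} (hf : MDiffAt f x) (hY : MDiffAt (T% Y) x) :
    nabla X (fun y ↦ f y • Y y) x = f x • nabla X Y x + dirDeriv X f x • Y x :=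
  congr($((leviCivita I M).isCovariantDerivativeOnUniv.leibniz hY hf) (X x))

theorem nabla_neg_right (X : Π x : M, TangentSpace I x) {Y : Π x : M, TangentSpace I x} {x : M}
    (hY : MDiffAt (T% Y) x) : nabla X (fun y ↦ -Y y) x = -nabla X Y x := by
  have h := nabla_smul_right X (f := fun _ ↦ (-1 : ℝ)) mdifferentiableAt_const hY
  have h0 : mvfderiv I (fun _ : M ↦ (-1 : ℝ)) x = 0 := mvfderiv_const _
  simpa [dirDeriv, h0] using h

theorem nabla_sub_right (X : Π x : M, TangentSpace I x) {Y Z : Π x : M, TangentSpace I x} {x : M}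
    (hY : MDiffAt (T% Y) x) (hZ : MDiffAt (T% Z) x) :
    nabla X (fun y ↦ Y y - Z y) x = nabla X Y x - nabla X Z x := by
  simp only [sub_eq_add_neg]
  rw [← nabla_neg_right X hZ]
  exact nabla_add_right X hY (mdifferentiableAt_neg_section hZ)

theorem nabla_congr_right (X : Π x : M, TangentSpace I x) {Y Z : Π x : M, TangentSpace I x} {x : M}
    (hY : MDiffAt (T% Y) x) (hZ : MDiffAt (T% Z) x) (h : Y =ᶠ[𝓝 x] Z) :
    nabla X Y x = nabla X Z x :=
  congr($((leviCivita I M).isCovariantDerivativeOnUniv.congr_of_eventuallyEq hY hZ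
    Filter.univ_mem h) (X x))

theorem nabla_congr_left {X Y : Π x : M, TangentSpace I x} {x : M} (h : X x = Y x)
    (Z : Π x : M, TangentSpace I x) : nabla X Z x = nabla Y Z x := by
  rw [nabla, h, nabla]

/-- The Levi-Civita connection is torsion-free. -/
theorem mlieBracket_eq_nabla {X Y : Π x : M, TangentSpace I x}
    (hX : IsSmoothField X) (hY : IsSmoothField Y) :
    mlieBracket I X Y = fun x ↦ nabla X Y x - nabla Y X x := by
  ext x
  exact (leviCivita_torsion (hX.mdiffAt x) (hY.mdiffAt x)).symm

/-- The Levi-Civita connection is metric. -/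
theorem dirDeriv_metric {X Y Z : Π x : M, TangentSpace I x}
    (hX : IsSmoothField X) (hY : IsSmoothField Y) (hZ : IsSmoothField Z) :
    dirDeriv X (metric Y Z) = fun x ↦ metric (nabla X Y) Z x + metric Y (nabla X Z) x := by
  ext x
  exact leviCivita_metric (hX.mdiffAt x) (hY.mdiffAt x) (hZ.mdiffAt x)

theorem curvatureField_swap {X Y : Π x : M, TangentSpace I x} (Z : Π x : M, TangentSpace I x)
    (x : M) : curvatureField X Y Z x = -curvatureField Y X Z x := by
  simp only [curvatureField_eq, nabla]
  rw [mlieBracket_swap_apply (V := X), map_neg]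
  abel

variable [T2Space M]

/-- `∇_X Y` is smooth because its inner products with smooth fields, given by the Koszul formula,
are. -/
theorem IsSmoothField.nabla {X Y : Π x : M, TangentSpace I x}
    (hX : IsSmoothField X) (hY : IsSmoothField Y) : IsSmoothField (nabla X Y) := by
  have : CompleteSpace E := FiniteDimensional.complete ℝ E
  refine isSmoothField_of_metric fun Z hZ ↦ ?_
  have h : SasakianSoliton.metric (SasakianSoliton.nabla X Y) Z = koszul X Y Z := by
    ext x
    exact inner_leviCivitaFun_field (hX.mdiffAt x) (hY.mdiffAt x) (hZ.mdiffAt x)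
  rw [h]
  exact contMDiff_const.mul ((((((contMDiff_dirDeriv (hY.metric hZ) hX).add
    (contMDiff_dirDeriv (hZ.metric hX) hY)).sub (contMDiff_dirDeriv (hX.metric hY) hZ)).sub
    (hX.metric (hY.mlieBracket hZ))).sub (hY.metric (hX.mlieBracket hZ))).add
    (hZ.metric (hX.mlieBracket hY)))

/-- If `Z` is smooth, then `∇_X Z` is differentiable wherever `X` is. -/
theorem mdiffAt_nabla {X Z : Π x : M, TangentSpace I x} {x : M}
    (hX : MDiffAt (T% X) x) (hZ : IsSmoothField Z) : MDiffAt (T% (nabla X Z)) x := by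
  set e := trivializationAt E (TangentSpace I : M → Type _) x with he
  have hx : x ∈ e.baseSet := FiberBundle.mem_baseSet_trivializationAt' x
  set b := Module.finBasis ℝ E
  have hW (i) := exists_smooth_extension (e.localFrame b i) (e.open_baseSet.mem_nhds hx)
    (e.contMDiffOn_localFrame_baseSet (I := I) ∞ b i)
  choose W hW hWe using hW
  have h1 : MDiffAt (T% fun y ↦ ∑ i, e.localFrameCoeff I b i y (X y) • nabla (W i) Z y) x :=
    .sum_section fun i _ ↦ (mdifferentiableAt_localFrameCoeff b hx hX i).smul_section
      (((hW i).nabla hZ).mdiffAt x)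
  refine h1.congr_of_eventuallyEq ?_
  filter_upwards [Filter.eventually_all.2 hWe, e.open_baseSet.mem_nhds hx] with y hy hye
  have h2 : nabla X Z y = ∑ i, e.localFrameCoeff I b i y (X y) • nabla (W i) Z y := by
    rw [nabla, e.eq_sum_localFrameCoeff_smul (I := I) (b := b) (s := X) hye, map_sum]
    refine Finset.sum_congr rfl fun i _ ↦ ?_
    rw [map_smul, nabla, hy i, ← e.eq_sum_localFrameCoeff_smul (I := I) (b := b) (s := X) hye]
  simp [h2]

end Connection

/-! ### Symmetries of the curvature -/

section Curvature

variable [IsManifold I ∞ M] [RiemannianBundle (fun x : M ↦ TangentSpace I x)]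
  [IsContMDiffRiemannianBundle I ∞ E (fun x : M ↦ TangentSpace I x)]
  [FiniteDimensional ℝ E] [T2Space M]

/-- `R(X,Y)` is skew-adjoint: differentiate `g(Z,W)` twice and use that `[X,Y]` acts as a
commutator. -/
theorem inner_curvatureField_swap {X Y Z W : Π x : M, TangentSpace I x}
    (hX : IsSmoothField X) (hY : IsSmoothField Y) (hZ : IsSmoothField Z) (hW : IsSmoothField W)
    (x : M) :
    inner ℝ (curvatureField X Y Z x) (W x) = -inner ℝ (curvatureField X Y W x) (Z x) := by
  have : CompleteSpace E := FiniteDimensional.complete ℝ E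
  have md {V V' : Π x : M, TangentSpace I x} (hV : IsSmoothField V) (hV' : IsSmoothField V') :
      MDiffAt (metric V V') x := metric_mdiff (hV.mdiffAt x) (hV'.mdiffAt x)
  have h := dirDeriv_mlieBracket (hZ.metric hW) hX hY x
  rw [dirDeriv_metric hX hZ hW, dirDeriv_metric hY hZ hW,
    dirDeriv_metric (hX.mlieBracket hY) hZ hW,
    dirDeriv_add X x (md (hY.nabla hZ) hW) (md hZ (hY.nabla hW)),
    dirDeriv_add Y x (md (hX.nabla hZ) hW) (md hZ (hX.nabla hW)),
    dirDeriv_metric hX (hY.nabla hZ) hW, dirDeriv_metric hX hZ (hY.nabla hW),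
    dirDeriv_metric hY (hX.nabla hZ) hW, dirDeriv_metric hY hZ (hX.nabla hW)] at h
  simp only [metric] at h
  simp only [curvatureField_eq, inner_sub_left]
  simp only [real_inner_comm (Z x)] at h ⊢
  linarith

/-- The first Bianchi identity. -/
theorem curvatureField_bianchi {X Y Z : Π x : M, TangentSpace I x}
    (hX : IsSmoothField X) (hY : IsSmoothField Y) (hZ : IsSmoothField Z) (x : M) :
    curvatureField X Y Z x + curvatureField Y Z X x + curvatureField Z X Y x = 0 := by
  have : CompleteSpace E := FiniteDimensional.complete ℝ E
  have key {U V W : Π x : M, TangentSpace I x} (hU : IsSmoothField U) (hV : IsSmoothField V)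
      (hW : IsSmoothField W) : nabla U (nabla V W) x - nabla U (nabla W V) x
        - nabla (mlieBracket I V W) U x = mlieBracket I U (mlieBracket I V W) x := by
    rw [mlieBracket_eq_nabla hU (hV.mlieBracket hW)]
    nth_rw 2 [mlieBracket_eq_nabla hV hW]
    exact congr($((nabla_sub_right U ((hV.nabla hW).mdiffAt x) ((hW.nabla hV).mdiffAt x)).symm) - _)
  have h1 := key hX hY hZ
  have h2 := key hY hZ hX
  have h3 := key hZ hX hY
  have hj := jacobi hX hY hZ x
  rw [mlieBracket_swap_apply (V := mlieBracket I X Y), mlieBracket_swap (V := X) (W := Z),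
    ← neg_one_smul ℝ (mlieBracket I Z X),
    mlieBracket_const_smul_right ((hZ.mlieBracket hX).mdiffAt x)] at hj
  simp only [curvatureField_eq]
  linear_combination (norm := module) h1 + h2 + h3 + hj

/-- The pair symmetry `g(R(X,Y)Z,W) = g(R(Z,W)X,Y)` of the curvature tensor. -/
theorem inner_curvatureField_pair {X Y Z W : Π x : M, TangentSpace I x}
    (hX : IsSmoothField X) (hY : IsSmoothField Y) (hZ : IsSmoothField Z) (hW : IsSmoothField W)
    (x : M) :
    inner ℝ (curvatureField X Y Z x) (W x) = inner ℝ (curvatureField Z W X x) (Y x) := by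
  have b {U V T S : Π x : M, TangentSpace I x} (hU : IsSmoothField U) (hV : IsSmoothField V)
      (hT : IsSmoothField T) : inner ℝ (curvatureField U V T x) (S x)
        + inner ℝ (curvatureField V T U x) (S x) + inner ℝ (curvatureField T U V x) (S x) = 0 := by
    rw [← inner_add_left, ← inner_add_left, curvatureField_bianchi hU hV hT, inner_zero_left]
  have s (U V T S : Π x : M, TangentSpace I x) : inner ℝ (curvatureField U V T x) (S x) =
      -inner ℝ (curvatureField V U T x) (S x) := by
    rw [curvatureField_swap, inner_neg_left]
  have b1 := b (S := W) hX hY hZ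
  have b2 := b (S := X) hY hZ hW
  have b3 := b (S := Y) hZ hW hX
  have b4 := b (S := Z) hW hX hY
  have := s X Z W Y
  have := s Y W X Z
  have := inner_curvatureField_swap hX hY hZ hW x
  have := inner_curvatureField_swap hY hZ hX hW x
  have := inner_curvatureField_swap hZ hX hY hW x
  have := inner_curvatureField_swap hZ hW hX hY x
  have := inner_curvatureField_swap hW hX hZ hY x
  have := inner_curvatureField_swap hW hY hZ hX x
  linarith

/-- `R(X,Y)Z` is tensorial in `X`. Tensoriality in the other arguments follows from the symmetries
of `R`. -/
theorem curvatureField_tensorial (Y : Π x : M, TangentSpace I x) {Z : Π x : M, TangentSpace I x}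
    (hZ : IsSmoothField Z) (x : M) :
    TensorialAt I E (fun X ↦ curvatureField X Y Z x) x where
  smul {f X} hf hX := by
    have : CompleteSpace E := FiniteDimensional.complete ℝ E
    have h1 : nabla (f • X) Z = fun y ↦ f y • nabla X Z y := by
      ext y; simp [nabla]
    simp only [curvatureField_eq, h1]
    rw [nabla_smul_right Y hf (mdiffAt_nabla hX hZ)]
    simp only [nabla]
    rw [mlieBracket_smul_left hf hX]
    simp only [Pi.smul_apply', map_smul, map_add, dirDeriv]
    module
  add {X X'} hX hX' := by
    have : CompleteSpace E := FiniteDimensional.complete ℝ E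
    have h1 : nabla (X + X') Z = fun y ↦ nabla X Z y + nabla X' Z y := by
      ext y; simp [nabla]
    simp only [curvatureField_eq, h1]
    rw [nabla_add_right Y (mdiffAt_nabla hX hZ) (mdiffAt_nabla hX' hZ)]
    simp only [nabla]
    rw [mlieBracket_add_left hX hX']
    simp only [Pi.add_apply, map_add]
    abel

/-- The curvature on vector fields is given by the curvature tensor. -/
theorem curvature_apply {X Y Z : Π x : M, TangentSpace I x}
    (hX : IsSmoothField X) (hY : IsSmoothField Y) (hZ : IsSmoothField Z) (x : M) :
    curvature x (X x) (Y x) (Z x) = curvatureField X Y Z x := by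
  have : CompleteSpace E := FiniteDimensional.complete ℝ E
  obtain ⟨U, hU, hUe⟩ := exists_smooth_eventuallyEq_extend (X x)
  obtain ⟨V, hV, hVe⟩ := exists_smooth_eventuallyEq_extend (Y x)
  obtain ⟨W, hW, hWe⟩ := exists_smooth_eventuallyEq_extend (Z x)
  have hUx : U x = X x := hUe.self_of_nhds.trans (extend_apply_self ..)
  have hVx : V x = Y x := hVe.self_of_nhds.trans (extend_apply_self ..)
  have hWx : W x = Z x := hWe.self_of_nhds.trans (extend_apply_self ..)
  -- the fields used in the definition of `curvature` may be cut off away from `x`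
  have h0 : curvature x (X x) (Y x) (Z x) = curvatureField U V W x := by
    have md {S : Π x : M, TangentSpace I x} {y : M} {s : TangentSpace I x}
        (hS : IsSmoothField S) (h : S =ᶠ[𝓝 y] (extend E s : Π x : M, TangentSpace I x)) :
        MDiffAt (T% (extend E s : Π x : M, TangentSpace I x)) y :=
      (hS.mdiffAt y).congr_of_eventuallyEq (h.mono fun z hz ↦ by simp [hz])
    have hn {S : Π x : M, TangentSpace I x} {s : TangentSpace I x} (hS : IsSmoothField S)
        (h : S =ᶠ[𝓝 x] (extend E s : Π x : M, TangentSpace I x)) :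
        nabla S W =ᶠ[𝓝 x] nabla (extend E s : Π x : M, TangentSpace I x)
          (extend E (Z x) : Π x : M, TangentSpace I x) := by
      filter_upwards [h, hWe.eventuallyEq_nhds] with y hy hWy
      rw [nabla_congr_left hy]
      exact nabla_congr_right _ (hW.mdiffAt y) (md hW hWy) hWy
    have md' {S T : Π x : M, TangentSpace I x} (hS : IsSmoothField S) (h : S =ᶠ[𝓝 x] T) :
        MDiffAt (T% T) x :=
      (hS.mdiffAt x).congr_of_eventuallyEq (h.mono fun z hz ↦ by simp [hz])
    rw [curvature, curvatureField_eq, curvatureField_eq,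
      ← nabla_congr_right _ ((hV.nabla hW).mdiffAt x) (md' (hV.nabla hW) (hn hV hVe)) (hn hV hVe),
      ← nabla_congr_right _ ((hU.nabla hW).mdiffAt x) (md' (hU.nabla hW) (hn hU hUe)) (hn hU hUe),
      ← nabla_congr_right _ (hW.mdiffAt x) (md' hW hWe) hWe,
      nabla_congr_left hUe.self_of_nhds, nabla_congr_left hVe.self_of_nhds,
      nabla_congr_left (hUe.mlieBracket_vectorField_eq hVe)]
  have hl {S T V W : Π x : M, TangentSpace I x} (hS : IsSmoothField S) (hT : IsSmoothField T)
      (hW : IsSmoothField W) (h : S x = T x) :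
      curvatureField S V W x = curvatureField T V W x :=
    (curvatureField_tensorial _ hW x).pointwise (hS.mdiffAt x) (hT.mdiffAt x) h
  -- the arguments are replaced one at a time, each being moved to the first slot
  rw [h0, hl hU hX hW hUx, curvatureField_swap, hl hV hY hW hVx, ← curvatureField_swap]
  refine ext_inner_right ℝ fun t ↦ ?_
  obtain ⟨T, hT, rfl⟩ := exists_smooth_field t
  rw [inner_curvatureField_pair hX hY hW hT, hl hW hZ hX hWx,
    ← inner_curvatureField_pair hX hY hZ hT]

theorem curvature_add_left (x : M) (u u' v w : TangentSpace I x) :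
    curvature x (u + u') v w = curvature x u v w + curvature x u' v w := by
  obtain ⟨U, hU, rfl⟩ := exists_smooth_field u
  obtain ⟨U', hU', rfl⟩ := exists_smooth_field u'
  obtain ⟨V, hV, rfl⟩ := exists_smooth_field v
  obtain ⟨W, hW, rfl⟩ := exists_smooth_field w
  rw [curvature_apply hU hV hW, curvature_apply hU' hV hW,
    ← (curvatureField_tensorial _ hW x).add (hU.mdiffAt x) (hU'.mdiffAt x)]
  exact curvature_apply (hU.add hU') hV hW x

theorem curvature_smul_left (x : M) (c : ℝ) (u v w : TangentSpace I x) :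
    curvature x (c • u) v w = c • curvature x u v w := by
  obtain ⟨U, hU, rfl⟩ := exists_smooth_field u
  obtain ⟨V, hV, rfl⟩ := exists_smooth_field v
  obtain ⟨W, hW, rfl⟩ := exists_smooth_field w
  rw [curvature_apply hU hV hW,
    ← (curvatureField_tensorial _ hW x).smul (f := fun _ ↦ c) mdifferentiableAt_const
      (hU.mdiffAt x)]
  exact curvature_apply (hU.smul contMDiff_const) hV hW x

theorem curvature_swap (x : M) (u v w : TangentSpace I x) :
    curvature x u v w = -curvature x v u w := by
  obtain ⟨U, hU, rfl⟩ := exists_smooth_field u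
  obtain ⟨V, hV, rfl⟩ := exists_smooth_field v
  obtain ⟨W, hW, rfl⟩ := exists_smooth_field w
  rw [curvature_apply hU hV hW, curvature_apply hV hU hW, curvatureField_swap]

theorem curvature_bianchi (x : M) (u v w : TangentSpace I x) :
    curvature x u v w + curvature x v w u + curvature x w u v = 0 := by
  obtain ⟨U, hU, rfl⟩ := exists_smooth_field u
  obtain ⟨V, hV, rfl⟩ := exists_smooth_field v
  obtain ⟨W, hW, rfl⟩ := exists_smooth_field w
  rw [curvature_apply hU hV hW, curvature_apply hV hW hU, curvature_apply hW hU hV,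
    curvatureField_bianchi hU hV hW]

theorem inner_curvature_swap (x : M) (u v w z : TangentSpace I x) :
    inner ℝ (curvature x u v w) z = -inner ℝ (curvature x u v z) w := by
  obtain ⟨U, hU, rfl⟩ := exists_smooth_field u
  obtain ⟨V, hV, rfl⟩ := exists_smooth_field v
  obtain ⟨W, hW, rfl⟩ := exists_smooth_field w
  obtain ⟨Z, hZ, rfl⟩ := exists_smooth_field z
  rw [curvature_apply hU hV hW, curvature_apply hU hV hZ, inner_curvatureField_swap hU hV hW hZ]

theorem inner_curvature_pair (x : M) (u v w z : TangentSpace I x) :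
    inner ℝ (curvature x u v w) z = inner ℝ (curvature x w z u) v := by
  obtain ⟨U, hU, rfl⟩ := exists_smooth_field u
  obtain ⟨V, hV, rfl⟩ := exists_smooth_field v
  obtain ⟨W, hW, rfl⟩ := exists_smooth_field w
  obtain ⟨Z, hZ, rfl⟩ := exists_smooth_field z
  rw [curvature_apply hU hV hW, curvature_apply hW hZ hU, inner_curvatureField_pair hU hV hW hZ]

end Curvature

/-! ### The structure equations of a Sasakian manifold -/

section Sasakian

variable [IsManifold I ∞ M] [RiemannianBundle (fun x : M ↦ TangentSpace I x)]
  {φ : Π x : M, TangentSpace I x →L[ℝ] TangentSpace I x}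
  {ξ : Π x : M, TangentSpace I x} {η : Π x : M, TangentSpace I x →L[ℝ] ℝ}
  {X Y Z : Π x : M, TangentSpace I x}

theorem IsSmoothField.phi (hM : IsSasakian φ ξ η) (hX : IsSmoothField X) :
    IsSmoothField (fun y ↦ φ y (X y)) :=
  ContMDiff.clm_bundle_apply hM.smooth_phi hX

theorem eta_comp_eq (hM : IsSasakian φ ξ η) (X : Π x : M, TangentSpace I x) :
    (fun y ↦ η y (X y)) = metric X ξ := by
  ext y
  exact (hM.inner_xi y (X y)).symm

theorem inner_xi_phi (hM : IsSasakian φ ξ η) (x : M) (v : TangentSpace I x) :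
    inner ℝ (ξ x) (φ x v) = 0 := by
  rw [real_inner_comm, hM.inner_xi, hM.eta_phi]

/-- The condition `dη(X,Y) = g(X, φY)`, written without the factor `1/2` and with `η = g(·, ξ)`. -/
theorem contact_eq (hM : IsSasakian φ ξ η) (hX : IsSmoothField X) (hY : IsSmoothField Y) (x : M) :
    dirDeriv X (metric Y ξ) x - dirDeriv Y (metric X ξ) x - metric (mlieBracket I X Y) ξ x =
      2 * inner ℝ (X x) (φ x (Y x)) := by
  have h := hM.contact X Y hX hY x
  rw [extDerivOneForm, eta_comp_eq hM, eta_comp_eq hM, ← hM.inner_xi] at h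
  rw [metric]
  linarith

/-- `£_ξ η = 0`, since `dη(ξ,X) = g(ξ, φX) = 0`. -/
theorem dirDeriv_xi_eta (hM : IsSasakian φ ξ η) (hX : IsSmoothField X) :
    dirDeriv ξ (metric X ξ) = metric (mlieBracket I ξ X) ξ := by
  ext x
  have h := contact_eq hM hM.smooth_xi hX x
  have h1 : metric ξ ξ = fun _ ↦ (1 : ℝ) := by
    ext y
    rw [metric, hM.inner_xi, hM.eta_xi]
  rw [inner_xi_phi hM, h1, dirDeriv_const] at h
  linarith

/-- `£_ξ φ = 0`: this is normality for the pair `ξ, X`, since `φξ = 0` and `dη(ξ,X) = 0`. -/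
theorem mlieBracket_xi_phi (hM : IsSasakian φ ξ η) (hX : IsSmoothField X) (x : M) :
    mlieBracket I ξ (fun y ↦ φ y (X y)) x = φ x (mlieBracket I ξ X x) := by
  have h1 := hM.normal ξ X hM.smooth_xi hX x
  have h2 : (fun y ↦ φ y (ξ y)) = 0 := by
    ext y
    exact hM.phi_xi y
  rw [hM.contact ξ X hM.smooth_xi hX, inner_xi_phi hM, nijenhuis, h2, mlieBracket_zero_left,
    mlieBracket_zero_left] at h1
  have h3 : η x (mlieBracket I ξ (fun y ↦ φ y (X y)) x) = 0 := by
    have h4 := congrFun (dirDeriv_xi_eta hM (hX.phi hM)) x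
    have h5 : metric (fun y ↦ φ y (X y)) ξ = fun _ ↦ (0 : ℝ) := by
      ext y
      rw [metric, hM.inner_xi, hM.eta_phi]
    rw [h5, dirDeriv_const, metric, hM.inner_xi] at h4
    exact h4.symm
  have h6 := congrArg (φ x) h1
  simp only [mul_zero, zero_smul, zero_add, Pi.zero_apply, add_zero, map_zero, sub_zero, map_sub,
    hM.phi_phi, map_add, map_neg, map_smul, hM.phi_xi, smul_zero, h3] at h6
  linear_combination (norm := module) h6

variable [IsContMDiffRiemannianBundle I ∞ E (fun x : M ↦ TangentSpace I x)]
  [FiniteDimensional ℝ E]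

/-- The covariant derivative `(∇_X φ)Y = ∇_X(φY) - φ(∇_X Y)`. -/
def nablaPhi (φ : Π x : M, TangentSpace I x →L[ℝ] TangentSpace I x)
    (X Y : Π x : M, TangentSpace I x) (x : M) : TangentSpace I x :=
  nabla X (fun y ↦ φ y (Y y)) x - φ x (nabla X Y x)

/-- `∇_X φ` is skew-adjoint, because `φ` is. -/
theorem inner_nablaPhi_swap (hM : IsSasakian φ ξ η) (hX : IsSmoothField X) (hY : IsSmoothField Y)
    (hZ : IsSmoothField Z) (x : M) :
    inner ℝ (nablaPhi φ X Y x) (Z x) = -inner ℝ (nablaPhi φ X Z x) (Y x) := by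
  have h1 : metric Y (fun y ↦ φ y (Z y)) = fun y ↦ (-1) * metric (fun y ↦ φ y (Y y)) Z y := by
    ext y
    simp [metric, hM.inner_phi_right]
  have h2 := congrArg (fun f ↦ dirDeriv X f x) h1
  rw [dirDeriv_mul X x mdifferentiableAt_const (mdiffAt_metric (hY.phi hM) hZ x), dirDeriv_const,
    dirDeriv_metric hX hY (hZ.phi hM), dirDeriv_metric hX (hY.phi hM) hZ] at h2
  simp only [metric, nablaPhi, inner_sub_left] at h2 ⊢
  have h3 := hM.inner_phi_right x (nabla X Y x) (Z x)
  have h4 := hM.inner_phi_right x (Y x) (nabla X Z x)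
  have h5 := real_inner_comm (Y x) (φ x (nabla X Z x))
  have h6 := real_inner_comm (Y x) (nabla X (fun y ↦ φ y (Z y)) x)
  linarith

/-- Normality in terms of `∇φ`: the Nijenhuis tensor is expanded with `[X,Y] = ∇_X Y - ∇_Y X`. -/
theorem nablaPhi_normal (hM : IsSasakian φ ξ η) (hX : IsSmoothField X) (hY : IsSmoothField Y)
    (x : M) :
    nablaPhi φ (fun y ↦ φ y (X y)) Y x - nablaPhi φ (fun y ↦ φ y (Y y)) X x
      - φ x (nablaPhi φ X Y x) + φ x (nablaPhi φ Y X x) =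
      -(2 * inner ℝ (X x) (φ x (Y x))) • ξ x := by
  have h := hM.normal X Y hX hY x
  rw [hM.contact X Y hX hY, nijenhuis, mlieBracket_eq_nabla hX hY,
    mlieBracket_eq_nabla (hX.phi hM) (hY.phi hM), mlieBracket_eq_nabla (hX.phi hM) hY,
    mlieBracket_eq_nabla hX (hY.phi hM)] at h
  simp only [map_sub] at h
  simp only [nablaPhi, map_sub]
  linear_combination (norm := module) h

variable [T2Space M]

/-- `£_ξ dη = d £_ξ η = 0`, in terms of the fundamental form `dη(X,Y) = g(X, φY)`. -/
theorem dirDeriv_xi_inner_phi (hM : IsSasakian φ ξ η) (hX : IsSmoothField X)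
    (hY : IsSmoothField Y) (x : M) :
    dirDeriv ξ (metric X (fun y ↦ φ y (Y y))) x =
      inner ℝ (mlieBracket I ξ X x) (φ x (Y x)) + inner ℝ (X x) (φ x (mlieBracket I ξ Y x)) := by
  have : CompleteSpace E := FiniteDimensional.complete ℝ E
  have hξ := hM.smooth_xi
  have md {f : M → ℝ} (hf : ContMDiff I 𝓘(ℝ) ∞ f) : MDiffAt f x :=
    (hf x).mdifferentiableAt (by simp)
  have h1 : dirDeriv X (metric Y ξ) = fun y ↦ 2 * metric X (fun y ↦ φ y (Y y)) y +
      (dirDeriv Y (metric X ξ) y + metric (mlieBracket I X Y) ξ y) := by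
    ext y
    have h := contact_eq hM hX hY y
    simp only [metric] at h ⊢
    linarith
  have h2 : dirDeriv ξ (dirDeriv X (metric Y ξ)) x =
      2 * dirDeriv ξ (metric X (fun y ↦ φ y (Y y))) x +
        (dirDeriv ξ (dirDeriv Y (metric X ξ)) x
          + dirDeriv ξ (metric (mlieBracket I X Y) ξ) x) := by
    rw [h1, dirDeriv_add, dirDeriv_add, dirDeriv_mul, dirDeriv_const]
    · ring
    · exact mdifferentiableAt_const
    · exact md (hX.metric (hY.phi hM))
    · exact md (contMDiff_dirDeriv (hX.metric hξ) hY)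
    · exact md ((hX.mlieBracket hY).metric hξ)
    · exact md (contMDiff_const.mul (hX.metric (hY.phi hM)))
    · exact md ((contMDiff_dirDeriv (hX.metric hξ) hY).add ((hX.mlieBracket hY).metric hξ))
  have h3 := dirDeriv_mlieBracket (hY.metric hξ) hξ hX x
  have h4 := dirDeriv_mlieBracket (hX.metric hξ) hξ hY x
  have h5 := contact_eq hM (hξ.mlieBracket hX) hY x
  have h6 := contact_eq hM hX (hξ.mlieBracket hY) x
  have h7 := congrArg (fun v ↦ inner ℝ v (ξ x)) (jacobi hξ hX hY x)
  rw [dirDeriv_xi_eta hM hX] at h4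
  rw [dirDeriv_xi_eta hM hY] at h3
  rw [dirDeriv_xi_eta hM (hX.mlieBracket hY)] at h2
  simp only [inner_add_left] at h7
  simp only [metric] at *
  linarith

/-- The field `ξ` is Killing, since `g(X,Y) = -dη(X, φY) + η(X) η(Y)` and `£_ξ` annihilates `dη`,
`φ` and `η`. -/
theorem dirDeriv_xi_metric (hM : IsSasakian φ ξ η) (hX : IsSmoothField X)
    (hY : IsSmoothField Y) (x : M) :
    dirDeriv ξ (metric X Y) x =
      inner ℝ (mlieBracket I ξ X x) (Y x) + inner ℝ (X x) (mlieBracket I ξ Y x) := by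
  have hξ := hM.smooth_xi
  have h1 : metric X Y = fun y ↦ (-1) * metric X (fun y ↦ φ y (φ y (Y y))) y
      + metric X ξ y * metric Y ξ y := by
    ext y
    simp only [metric, hM.phi_phi, inner_add_right, inner_neg_right, inner_smul_right, hM.inner_xi]
    ring
  rw [h1, dirDeriv_add, dirDeriv_mul, dirDeriv_mul, dirDeriv_const,
    dirDeriv_xi_inner_phi hM hX (hY.phi hM), mlieBracket_xi_phi hM hY, dirDeriv_xi_eta hM hX,
    dirDeriv_xi_eta hM hY]
  · simp only [metric, hM.phi_phi, inner_add_right, inner_neg_right, inner_smul_right, hM.inner_xi]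
    ring
  · exact mdiffAt_metric hX hξ x
  · exact mdiffAt_metric hY hξ x
  · exact mdifferentiableAt_const
  · exact mdiffAt_metric hX ((hY.phi hM).phi hM) x
  · exact mdifferentiableAt_const.mul (mdiffAt_metric hX ((hY.phi hM).phi hM) x)
  · exact (mdiffAt_metric hX hξ x).mul (mdiffAt_metric hY hξ x)

/-- `∇_X ξ = -φX`: the symmetric part of `∇ξ` vanishes since `ξ` is Killing, and the skew part is
`dη`. -/
theorem nabla_xi (hM : IsSasakian φ ξ η) (hX : IsSmoothField X) :
    nabla X ξ = fun x ↦ -φ x (X x) := by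
  ext x
  refine ext_inner_right ℝ fun w ↦ ?_
  obtain ⟨Y, hY, rfl⟩ := exists_smooth_field w
  have hξ := hM.smooth_xi
  have h1 := dirDeriv_xi_metric hM hX hY x
  have h2 := contact_eq hM hX hY x
  rw [dirDeriv_metric hξ hX hY, mlieBracket_eq_nabla hξ hX, mlieBracket_eq_nabla hξ hY] at h1
  rw [dirDeriv_metric hX hY hξ, dirDeriv_metric hY hX hξ, mlieBracket_eq_nabla hX hY,
    hM.inner_phi_right] at h2
  simp only [metric, inner_sub_left, inner_sub_right] at h1 h2
  rw [inner_neg_left]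
  rw [real_inner_comm (nabla X ξ x)] at h2
  linarith

/-- `R(X,Y)ξ = (∇_Y φ)X - (∇_X φ)Y`, from `∇ξ = -φ`. -/
theorem curvatureField_xi_eq (hM : IsSasakian φ ξ η) (hX : IsSmoothField X) (hY : IsSmoothField Y)
    (x : M) : curvatureField X Y ξ x = nablaPhi φ Y X x - nablaPhi φ X Y x := by
  have : CompleteSpace E := FiniteDimensional.complete ℝ E
  rw [curvatureField_eq, nabla_xi hM hX, nabla_xi hM hY, nabla_xi hM (hX.mlieBracket hY),
    nabla_neg_right X ((hY.phi hM).mdiffAt x), nabla_neg_right Y ((hX.phi hM).mdiffAt x),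
    mlieBracket_eq_nabla hX hY]
  simp only [nablaPhi, map_sub]
  abel

/-- The fundamental form is closed. In view of `R(X,Y)ξ = (∇_Y φ)X - (∇_X φ)Y`, this is the
`ξ`-component of the first Bianchi identity. -/
theorem inner_nablaPhi_cyclic (hM : IsSasakian φ ξ η) (hX : IsSmoothField X) (hY : IsSmoothField Y)
    (hZ : IsSmoothField Z) (x : M) :
    inner ℝ (nablaPhi φ X Y x) (Z x) + inner ℝ (nablaPhi φ Y Z x) (X x)
      + inner ℝ (nablaPhi φ Z X x) (Y x) = 0 := by
  have hξ := hM.smooth_xi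
  have key {U V W : Π x : M, TangentSpace I x} (hU : IsSmoothField U) (hV : IsSmoothField V)
      (hW : IsSmoothField W) : inner ℝ (curvatureField U V W x) (ξ x) =
        inner ℝ (nablaPhi φ U V x) (W x) + inner ℝ (nablaPhi φ V W x) (U x) := by
    rw [inner_curvatureField_swap hU hV hW hξ, curvatureField_xi_eq hM hU hV, inner_sub_left,
      inner_nablaPhi_swap hM hV hU hW]
    ring
  have h := congrArg (fun v ↦ inner ℝ v (ξ x)) (curvatureField_bianchi hX hY hZ x)
  simp only [inner_add_left, inner_zero_left] at h
  rw [key hX hY hZ, key hY hZ hX, key hZ hX hY] at h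
  linarith

/-- The covariant derivative of `φ² = -1 + η ⊗ ξ`. -/
theorem nablaPhi_phi (hM : IsSasakian φ ξ η) (hX : IsSmoothField X) (hY : IsSmoothField Y) (x : M) :
    nablaPhi φ X (fun y ↦ φ y (Y y)) x + φ x (nablaPhi φ X Y x) =
      -inner ℝ (Y x) (φ x (X x)) • ξ x - η x (Y x) • φ x (X x) := by
  have hξ := hM.smooth_xi
  have h1 : (fun y ↦ φ y (φ y (Y y))) = fun y ↦ -Y y + metric Y ξ y • ξ y := by
    ext y
    rw [hM.phi_phi, metric, hM.inner_xi]
  simp only [nablaPhi, map_sub]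
  rw [h1, nabla_add_right X (hY.neg.mdiffAt x) ((hξ.smul (hY.metric hξ)).mdiffAt x),
    nabla_neg_right X (hY.mdiffAt x),
    nabla_smul_right X (mdiffAt_metric hY hξ x) (hξ.mdiffAt x), hM.phi_phi,
    dirDeriv_metric hX hY hξ, nabla_xi hM hX]
  simp only [metric, inner_neg_right, hM.inner_xi]
  module

/-- The algebra behind `∇φ = 0` on Kähler manifolds: an expression `D(X,Y,Z)` that is skew in
`Y` and `Z`, has vanishing cyclic sum, satisfies `D(X,φY,Z) = D(X,Y,φZ)` and the identity
coming from the vanishing of the Nijenhuis tensor, vanishes on the image of `φ`. -/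
theorem apply_eq_zero_of_integrable {α : Type*} (D : α → α → α → ℝ) (f : α → α)
    (skew : ∀ X Y Z, D X Y Z = -D X Z Y) (cyc : ∀ X Y Z, D X Y Z + D Y Z X + D Z X Y = 0)
    (hf : ∀ X Y Z, D X (f Y) Z = D X Y (f Z))
    (normal : ∀ X Y Z, D (f X) Y Z + D X Y (f Z) = D (f Y) X Z + D Y X (f Z)) (X Y Z : α) :
    D X Y (f Z) = 0 := by
  -- an expression symmetric in `X, Y` and skew in `Y, Z` vanishes
  have hE (X Y Z) : D (f X) Y Z + D X Y (f Z) = 0 := by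
    have s (X Y Z) : D (f X) Y Z + D X Y (f Z) = -(D (f X) Z Y + D X Z (f Y)) := by
      linarith [skew (f X) Y Z, hf X Y Z, skew X (f Y) Z]
    linarith [normal X Y Z, s Y X Z, normal Y Z X, s Z Y X, normal Z X Y, s X Z Y]
  linarith [cyc (f X) Y Z, cyc X (f Y) Z, cyc X Y (f Z), hE X Y Z, hE Y Z X, hE Z X Y, hf X Y Z,
    hf Y Z X, hf Z X Y]

/-- `(∇_X φ)Y = g(X,Y)ξ - η(Y)X`. The difference of the two sides satisfies the identities that
force `∇φ = 0` on a Kähler manifold, so it vanishes on the image of `φ`; skewness takes care of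
`ξ`. -/
theorem nablaPhi_eq (hM : IsSasakian φ ξ η) (hX : IsSmoothField X) (hY : IsSmoothField Y) (x : M) :
    nablaPhi φ X Y x = inner ℝ (X x) (Y x) • ξ x - η x (Y x) • X x := by
  have hξ := hM.smooth_xi
  have comm (v w : TangentSpace I x) : inner ℝ (φ x v) w = -inner ℝ v (φ x w) := by
    rw [hM.inner_phi_right, neg_neg]
  -- the difference of both sides, as a trilinear form
  let D (X Y : Π x : M, TangentSpace I x) (w : TangentSpace I x) : ℝ :=
    inner ℝ (nablaPhi φ X Y x) w - inner ℝ (X x) (Y x) * η x w + η x (Y x) * inner ℝ (X x) w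
  have skew {U V W : Π x : M, TangentSpace I x} (hU : IsSmoothField U) (hV : IsSmoothField V)
      (hW : IsSmoothField W) : D U V (W x) = -D U W (V x) := by
    simp only [D]
    rw [inner_nablaPhi_swap hM hU hV hW]
    ring
  have hD {U V : Π x : M, TangentSpace I x} (hU : IsSmoothField U) (hV : IsSmoothField V)
      (w : TangentSpace I x) : D U V (φ x w) = 0 := by
    obtain ⟨W, hW, rfl⟩ := exists_smooth_field w
    refine apply_eq_zero_of_integrable (α := {X : Π x : M, TangentSpace I x // IsSmoothField X})
      (fun X Y Z ↦ D X.1 Y.1 (Z.1 x)) (fun X ↦ ⟨fun y ↦ φ y (X.1 y), X.2.phi hM⟩)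
      (fun X Y Z ↦ skew X.2 Y.2 Z.2) (fun X Y Z ↦ ?_) (fun X Y Z ↦ ?_) (fun X Y Z ↦ ?_)
      ⟨U, hU⟩ ⟨V, hV⟩ ⟨W, hW⟩
    · have h := inner_nablaPhi_cyclic hM X.2 Y.2 Z.2 x
      simp only [D]
      rw [real_inner_comm (X.1 x) (Z.1 x), real_inner_comm (Y.1 x) (X.1 x),
        real_inner_comm (Z.1 x) (Y.1 x)]
      linarith
    · have h := congrArg (fun v ↦ inner ℝ v (Z.1 x)) (nablaPhi_phi hM X.2 Y.2 x)
      simp only [inner_add_left, inner_sub_left, inner_smul_left, real_inner_comm _ (ξ x),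
        hM.inner_xi, RCLike.conj_to_real] at h
      rw [real_inner_comm (φ x (X.1 x)) (Y.1 x)] at h
      simp only [comm] at h
      simp only [D, hM.eta_phi]
      linarith
    · have h := congrArg (fun v ↦ inner ℝ v (Z.1 x)) (nablaPhi_normal hM X.2 Y.2 x)
      simp only [inner_add_left, inner_sub_left, inner_smul_left, comm, real_inner_comm _ (ξ x),
        hM.inner_xi, RCLike.conj_to_real] at h
      simp only [D, hM.eta_phi, comm]
      have h1 := hM.inner_phi_right x (X.1 x) (Y.1 x)
      rw [real_inner_comm (Y.1 x)] at h1
      rw [h1] at h ⊢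
      linarith
  have hDxi {U V W : Π x : M, TangentSpace I x} (hU : IsSmoothField U) (hV : IsSmoothField V)
      (hW : IsSmoothField W) : D U V (W x) = η x (W x) * D U V (ξ x) := by
    have h := hD hU hV (φ x (W x))
    rw [hM.phi_phi] at h
    simp only [D, inner_add_right, inner_neg_right, inner_smul_right, map_add, map_neg, map_smul,
      smul_eq_mul] at h ⊢
    linarith
  refine ext_inner_right ℝ fun w ↦ ?_
  obtain ⟨W, hW, rfl⟩ := exists_smooth_field w
  have h : D X Y (W x) = 0 := by
    have h0 : D X ξ (ξ x) = 0 := by linarith [skew hX hξ hξ]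
    rw [hDxi hX hY hW, skew hX hY hξ, hDxi hX hξ hY, h0]
    ring
  simp only [D] at h
  rw [inner_sub_left, inner_smul_left, inner_smul_left, real_inner_comm (W x) (ξ x), hM.inner_xi]
  simp only [RCLike.conj_to_real]
  linarith

/-- `R(u,v)ξ = η(v)u - η(u)v`. -/
theorem curvature_xi (hM : IsSasakian φ ξ η) (x : M) (u v : TangentSpace I x) :
    curvature x u v (ξ x) = η x v • u - η x u • v := by
  obtain ⟨U, hU, rfl⟩ := exists_smooth_field u
  obtain ⟨V, hV, rfl⟩ := exists_smooth_field v
  rw [curvature_apply hU hV hM.smooth_xi, curvatureField_xi_eq hM hU hV, nablaPhi_eq hM hU hV,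
    nablaPhi_eq hM hV hU, real_inner_comm]
  module

/-- The formula for `∇φ` as an equality of vector fields. The terms are grouped for the use of
`nabla_add_right` and `nabla_neg_right`. -/
theorem nabla_phi (hM : IsSasakian φ ξ η) (hX : IsSmoothField X) (hY : IsSmoothField Y) :
    nabla X (fun y ↦ φ y (Y y)) =
      fun y ↦ φ y (nabla X Y y) + (metric X Y y • ξ y + -(metric Y ξ y • X y)) := by
  ext y
  have h := nablaPhi_eq hM hX hY y
  simp only [nablaPhi] at h
  simp only [metric, hM.inner_xi]
  linear_combination (norm := module) h

/-- The commutator of `R(u,v)` with `φ`, from differentiating `(∇_X φ)Y = g(X,Y)ξ - η(Y)X`. -/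
theorem curvature_phi (hM : IsSasakian φ ξ η) (x : M) (u v w : TangentSpace I x) :
    curvature x u v (φ x w) = φ x (curvature x u v w) + inner ℝ (φ x u) w • v
      - inner ℝ (φ x v) w • u - inner ℝ v w • φ x u + inner ℝ u w • φ x v := by
  obtain ⟨X, hX, rfl⟩ := exists_smooth_field u
  obtain ⟨Y, hY, rfl⟩ := exists_smooth_field v
  obtain ⟨Z, hZ, rfl⟩ := exists_smooth_field w
  have : CompleteSpace E := FiniteDimensional.complete ℝ E
  have hξ := hM.smooth_xi
  have key {U V : Π x : M, TangentSpace I x} (hU : IsSmoothField U) (hV : IsSmoothField V) :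
      nabla U (nabla V fun y ↦ φ y (Z y)) x = φ x (nabla U (nabla V Z) x)
        + inner ℝ (U x) (nabla V Z x) • ξ x - η x (nabla V Z x) • U x
        + (inner ℝ (nabla U V x) (Z x) + inner ℝ (V x) (nabla U Z x)) • ξ x
        - inner ℝ (V x) (Z x) • φ x (U x)
        - (η x (nabla U Z x) - inner ℝ (φ x (U x)) (Z x)) • V x - η x (Z x) • nabla U V x := by
    have hVZ := hV.nabla hZ
    have h1 := hξ.smul (hV.metric hZ)
    have h2 := hV.smul (hZ.metric hξ)
    rw [nabla_phi hM hV hZ, nabla_add_right U ((hVZ.phi hM).mdiffAt x) ((h1.add h2.neg).mdiffAt x),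
      nabla_add_right U (h1.mdiffAt x) (h2.neg.mdiffAt x), nabla_neg_right U (h2.mdiffAt x),
      nabla_smul_right U (mdiffAt_metric hV hZ x) (hξ.mdiffAt x),
      nabla_smul_right U (mdiffAt_metric hZ hξ x) (hV.mdiffAt x),
      nabla_phi hM hU hVZ, dirDeriv_metric hU hV hZ, dirDeriv_metric hU hZ hξ, nabla_xi hM hU]
    simp only [metric, hM.inner_xi, inner_neg_right, real_inner_comm (φ x (U x)) (Z x)]
    module
  have hbr := congrFun (mlieBracket_eq_nabla hX hY) x
  have h3 : nabla (mlieBracket I X Y) Z x = nabla (nabla X Y) Z x - nabla (nabla Y X) Z x := by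
    simp only [nabla]
    rw [hbr]
    simp [nabla]
  rw [curvature_apply hX hY hZ, curvature_apply hX hY (hZ.phi hM), curvatureField_eq,
    curvatureField_eq, key hX hY, key hY hX, nabla_phi hM (hX.mlieBracket hY) hZ]
  simp only [metric, hM.inner_xi, h3, hbr, map_sub, inner_sub_left]
  module

end Sasakian

/-! ### The Ricci and `*`-Ricci tensors -/

section Ricci

/-- Summing a bilinear form over an orthonormal basis, a skew operator can be moved from one
argument to the other at the cost of a sign. -/
theorem sum_bilin_skew {V ι : Type*} [Fintype ι] [NormedAddCommGroup V] [InnerProductSpace ℝ V]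
    (e : OrthonormalBasis ι ℝ V) (A : V →L[ℝ] V) (hA : ∀ v w, inner ℝ v (A w) = -inner ℝ (A v) w)
    (B : V →ₗ[ℝ] V →ₗ[ℝ] ℝ) : ∑ i, B (A (e i)) (e i) = -∑ i, B (e i) (A (e i)) := by
  have h1 (i) : B (e i) (A (e i)) = ∑ j, inner ℝ (e j) (A (e i)) * B (e i) (e j) := by
    conv_lhs => rw [← e.sum_repr' (A (e i))]
    simp
  have h2 (i) : B (A (e i)) (e i) = ∑ j, inner ℝ (e j) (A (e i)) * B (e j) (e i) := by
    conv_lhs => rw [← e.sum_repr' (A (e i))]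
    simp
  simp only [h1, h2]
  rw [Finset.sum_comm, ← Finset.sum_neg_distrib]
  refine Finset.sum_congr rfl fun i _ ↦ ?_
  rw [← Finset.sum_neg_distrib]
  refine Finset.sum_congr rfl fun j _ ↦ ?_
  rw [hA, real_inner_comm]
  ring

variable [IsManifold I ∞ M] [RiemannianBundle (fun x : M ↦ TangentSpace I x)]
  [IsContMDiffRiemannianBundle I ∞ E (fun x : M ↦ TangentSpace I x)]
  [FiniteDimensional ℝ E] [T2Space M]
  {φ : Π x : M, TangentSpace I x →L[ℝ] TangentSpace I x}
  {ξ : Π x : M, TangentSpace I x} {η : Π x : M, TangentSpace I x →L[ℝ] ℝ}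

/-- On a Sasakian manifold of dimension `m`, `S* = S - (m - 2) g - η ⊗ η`. The Bianchi identity
turns `S*(u,v)` into the trace of `w ↦ R(w,u)φv` against `φ`, and commuting `φ` past `R` leaves
`S(u,v)`. -/
theorem starRicci_eq (hM : IsSasakian φ ξ η) (x : M) (u v : TangentSpace I x) :
    starRicci φ x u v = ricci x u v - ((Module.finrank ℝ E : ℝ) - 2) * inner ℝ u v
      - η x u * η x v := by
  have comm (v w : TangentSpace I x) : inner ℝ (φ x v) w = -inner ℝ v (φ x w) := by
    rw [hM.inner_phi_right, neg_neg]
  set e := stdOrthonormalBasis ℝ (TangentSpace I x) with he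
  let B : TangentSpace I x →ₗ[ℝ] TangentSpace I x →ₗ[ℝ] ℝ :=
    LinearMap.mk₂ ℝ (fun a b ↦ inner ℝ (curvature x a u (φ x v)) b)
      (fun a a' b ↦ by rw [curvature_add_left, inner_add_left])
      (fun c a b ↦ by rw [curvature_smul_left, real_inner_smul_left, smul_eq_mul])
      (fun a b b' ↦ inner_add_right _ _ _) (fun c a b ↦ real_inner_smul_right _ _ _)
  have hB (a b) : B a b = inner ℝ (curvature x a u (φ x v)) b := rfl
  -- by the Bianchi identity and pair symmetry, the trace is a sum of values of `B`
  have h1 (w : TangentSpace I x) :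
      inner ℝ (φ x (curvature x u (φ x v) w)) w = B w (φ x w) - B (φ x w) w := by
    have h2 := congrArg (fun t ↦ inner ℝ t (φ x v)) (curvature_bianchi x w (φ x w) u)
    simp only [inner_add_left, inner_zero_left] at h2
    rw [comm, inner_curvature_pair, hB, hB, inner_curvature_swap x w u,
      inner_curvature_swap x (φ x w) u]
    have h3 : inner ℝ (curvature x u w (φ x w)) (φ x v) =
        -inner ℝ (curvature x w u (φ x w)) (φ x v) := by
      rw [curvature_swap, inner_neg_left]
    linarith
  have h4 : starRicci φ x u v = ∑ i, B (e i) (φ x (e i)) := by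
    rw [starRicci, traceTangent, ← he]
    simp only [h1]
    rw [Finset.sum_sub_distrib, sum_bilin_skew e (φ x) (hM.inner_phi_right x) B]
    ring
  have h5 (i) : B (e i) (φ x (e i)) = inner ℝ (curvature x (e i) u v) (e i)
      + inner ℝ (φ x u) (e i) * inner ℝ (e i) (φ x v) - inner ℝ u v
      + inner ℝ u (e i) * inner ℝ (e i) v := by
    have h6 : η x (curvature x (e i) u v) =
        -(η x u * inner ℝ (e i) v - η x (e i) * inner ℝ u v) := by
      rw [← hM.inner_xi, inner_curvature_swap, curvature_xi hM, inner_sub_left,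
        real_inner_smul_left, real_inner_smul_left]
    have h7 : inner ℝ (e i) (φ x (e i)) = 0 := by
      have := hM.inner_phi_right x (e i) (e i)
      rw [real_inner_comm] at this ⊢
      linarith
    have h8 : inner ℝ (e i) (e i) = (1 : ℝ) := by
      rw [real_inner_self_eq_norm_sq, e.norm_eq_one, one_pow]
    rw [hB, curvature_phi hM]
    simp only [inner_add_left, inner_sub_left, real_inner_smul_left, hM.inner_phi_phi, h6, h7, h8,
      comm (e i), hM.inner_phi_right x u]
    ring
  rw [h4, ricci, traceTangent, ← he]
  simp only [h5]
  rw [Finset.sum_add_distrib, Finset.sum_sub_distrib, Finset.sum_add_distrib,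
    e.sum_inner_mul_inner, e.sum_inner_mul_inner, hM.inner_phi_phi, Finset.sum_const,
    Finset.card_univ, Fintype.card_fin, nsmul_eq_mul]
  have hm : (Module.finrank ℝ (TangentSpace I x) : ℝ) = Module.finrank ℝ E := rfl
  linear_combination (-inner ℝ u v) * hm

theorem starRicci_xi (hM : IsSasakian φ ξ η) (x : M) (u : TangentSpace I x) :
    starRicci φ x u (ξ x) = 0 := by
  have h (w : TangentSpace I x) : curvature x u 0 w = 0 := by
    rw [curvature_swap]
    simpa using curvature_smul_left x 0 0 u w
  simp [starRicci, traceTangent, hM.phi_xi, h]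

/-- A Sasakian manifold that carries a `*`-conformal `η`-Ricci soliton is `η`-Einstein, with
constant coefficients. -/
theorem ricci_eq_of_soliton (hM : IsSasakian φ ξ η) {lam mu : ℝ} {p : M → ℝ}
    (hsol : IsStarConformalEtaRicciSoliton φ ξ η lam mu p) (x : M) (u v : TangentSpace I x) :
    ricci x u v = ((Module.finrank ℝ E : ℝ) - 2 + mu) * inner ℝ u v
      + (1 - mu) * (η x u * η x v) := by
  have key {X Y : Π x : M, TangentSpace I x} (hX : IsSmoothField X) (hY : IsSmoothField Y) :
      2 * starRicci φ x (X x) (Y x)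
        + (2 * lam - (p x + 2 / (Module.finrank ℝ E : ℝ))) * inner ℝ (X x) (Y x)
        + 2 * mu * (η x (X x) * η x (Y x)) = 0 := by
    have h := hsol X Y hX hY x
    rw [lieDerivMetric, dirDeriv_xi_metric hM hX hY] at h
    linarith
  obtain ⟨U, hU, rfl⟩ := exists_smooth_field u
  obtain ⟨V, hV, rfl⟩ := exists_smooth_field v
  -- evaluation at `(ξ, ξ)` determines the function `p`
  have h1 := key hM.smooth_xi hM.smooth_xi
  rw [starRicci_xi hM, hM.inner_xi, hM.eta_xi] at h1
  have h2 := key hU hV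
  rw [starRicci_eq hM,
    show 2 * lam - (p x + 2 / (Module.finrank ℝ E : ℝ)) = -(2 * mu) by linarith] at h2
  linarith

/-- For `S = a g + b η ⊗ η` with constants `a`, `b`, only `∇η` contributes to `∇S`, and
`(∇_X η)(Y) = -g(Y, φX)`. -/
theorem covDerivTensor_etaEinstein (hM : IsSasakian φ ξ η) (a b : ℝ)
    {X Y Z : Π x : M, TangentSpace I x} (hX : IsSmoothField X) (hY : IsSmoothField Y)
    (hZ : IsSmoothField Z) (x : M) :
    covDerivTensor (fun y v w ↦ a * inner ℝ v w + b * (η y v * η y w)) X Y Z x =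
      -b * (inner ℝ (Y x) (φ x (X x)) * η x (Z x) + η x (Y x) * inner ℝ (Z x) (φ x (X x))) := by
  have hξ := hM.smooth_xi
  have h1 : (fun y ↦ a * inner ℝ (Y y) (Z y) + b * (η y (Y y) * η y (Z y))) =
      fun y ↦ a * metric Y Z y + b * (metric Y ξ y * metric Z ξ y) := by
    ext y
    simp only [metric, hM.inner_xi]
  have mYZ := mdiffAt_metric hY hZ x
  have mY := mdiffAt_metric hY hξ x
  have mZ := mdiffAt_metric hZ hξ x
  have mYZξ : MDiffAt (fun y ↦ metric Y ξ y * metric Z ξ y) x := mY.mul mZ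
  have ma : MDiffAt (fun y ↦ a * metric Y Z y) x := mdifferentiableAt_const.mul mYZ
  have mb : MDiffAt (fun y ↦ b * (metric Y ξ y * metric Z ξ y)) x :=
    mdifferentiableAt_const.mul mYZξ
  rw [covDerivTensor, h1, dirDeriv_add X x ma mb, dirDeriv_mul X x mdifferentiableAt_const mYZ,
    dirDeriv_mul X x mdifferentiableAt_const mYZξ, dirDeriv_mul X x mY mZ,
    dirDeriv_const, dirDeriv_const, dirDeriv_metric hX hY hZ, dirDeriv_metric hX hY hξ,
    dirDeriv_metric hX hZ hξ, nabla_xi hM hX]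
  simp only [metric, hM.inner_xi, inner_neg_right]
  simp only [nabla]
  ring

end Ricci

end SasakianSoliton

end

theorem theorem3p1 {n : ℕ} {M : Type*} [TopologicalSpace M] [T2Space M]
    [ChartedSpace (EuclideanSpace ℝ (Fin (2 * n + 1))) M] [IsManifold (𝓡 (2 * n + 1)) ∞ M]
    [RiemannianBundle (fun x : M ↦ TangentSpace (𝓡 (2 * n + 1)) x)]
    [IsContMDiffRiemannianBundle (𝓡 (2 * n + 1)) ∞ (EuclideanSpace ℝ (Fin (2 * n + 1)))
      (fun x : M ↦ TangentSpace (𝓡 (2 * n + 1)) x)]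
    (φ : Π x : M, TangentSpace (𝓡 (2 * n + 1)) x →L[ℝ] TangentSpace (𝓡 (2 * n + 1)) x)
    (ξ : Π x : M, TangentSpace (𝓡 (2 * n + 1)) x)
    (η : Π x : M, TangentSpace (𝓡 (2 * n + 1)) x →L[ℝ] ℝ)
    (hM : SasakianSoliton.IsSasakian φ ξ η)
    (lam mu : ℝ) (p : M → ℝ)
    (hsol : SasakianSoliton.IsStarConformalEtaRicciSoliton φ ξ η lam mu p)
    (X Y Z : Π x : M, TangentSpace (𝓡 (2 * n + 1)) x)
    (hX : SasakianSoliton.IsSmoothField X) (hY : SasakianSoliton.IsSmoothField Y)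
    (hZ : SasakianSoliton.IsSmoothField Z) (x : M) :
    SasakianSoliton.covDerivTensor (fun y ↦ SasakianSoliton.ricci y) X Y Z x
      + SasakianSoliton.covDerivTensor (fun y ↦ SasakianSoliton.ricci y) Y Z X x
      + SasakianSoliton.covDerivTensor (fun y ↦ SasakianSoliton.ricci y) Z X Y x = 0 := by
  have hS : (fun y ↦ SasakianSoliton.ricci y) = fun (y : M) v w ↦ _ * inner ℝ v w + _ * (_ * _) :=
    funext fun y ↦ funext fun v ↦ funext fun w ↦ SasakianSoliton.ricci_eq_of_soliton hM hsol y v w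
  have skew (V W : Π x : M, TangentSpace (𝓡 (2 * n + 1)) x) :
      inner ℝ (V x) (φ x (W x)) = -inner ℝ (W x) (φ x (V x)) := by
    rw [hM.inner_phi_right, real_inner_comm]
  rw [hS, SasakianSoliton.covDerivTensor_etaEinstein hM _ _ hX hY hZ,
    SasakianSoliton.covDerivTensor_etaEinstein hM _ _ hY hZ hX,
    SasakianSoliton.covDerivTensor_etaEinstein hM _ _ hZ hX hY, skew Y X, skew Z X, skew Z Y]
  ring
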